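/- Let $d\in\mathbb N$, $T>0$, $\alpha\in(0,1)$, $N=\lfloor 1/\alpha\rfloor$, and let $\mathbb W_d$ be the set of words in the letters $1,\dots,d$. For $r\ge 0$ let $\mathscr C^\alpha([0,r];\mathbb R^d)$ be the set of $\alpha$-Hölder rough paths, i.e. of maps $\mathbf X=(1,X^1,\dots,X^N)$ from $\{0\le s\le t\le r\}$ to $T^{N}(\mathbb R^d)=\bigoplus_{m=0}^N(\mathbb R^d)^{\otimes m}$ with $\mathbf X_{s,t}=\mathbf X_{s,u}\otimes\mathbf X_{u,t}$ (in $T^N$) for $s\le u\le t$ and $|\langle\mathbf X_{s,t},e_I\rangle|\le C|t-s|^{|I|\alpha}$ for $|I|\le N$. The signature $Sig(\mathbf X)$ is the unique extension of $\mathbf X$ to a map into $T((\mathbb R^d))=\prod_{m\ge0}(\mathbb R^d)^{\otimes m}$ that satisfies $Sig(\mathbf X)_{s,u}\otimes Sig(\mathbf X)_{u,t}=Sig(\mathbf X)_{s,t}$ and $|\langle Sig(\mathbf X)_{s,t},e_I\rangle|\le C_{|I|}|t-s|^{|I|\alpha}$ for all words $I$. Let $\Lambda=\bigcup_{r\in[0,T]}\mathscr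 C^\alpha([0,r];\mathbb R^d)$, and for $\mathbf Y\in\mathscr C^\alpha([0,r];\mathbb R^d)$, $\mathbf Z\in\mathscr C^\alpha([0,r'];\mathbb R^d)$ put $K_{sig}(\mathbf Y,\mathbf Z)=\langle Sig(\mathbf Y)_{0,r},Sig(\mathbf Z)_{0,r'}\rangle_{\ell^2(\mathbb W_d)}$. For a Banach space $W$, a map $\mathbf F:[0,T]\to\mathcal L(T^{N-1}(\mathbb R^d);W)$ is controlled by $\mathbf X\in\mathscr C^\alpha([0,T];\mathbb R^d)$, and lifts the path $t\mapsto\mathbf F_t[1]\in W$, if there is $C$ such that for all $s\le t$ and $|I|\le N-1$ $$\|\mathbf F_t[e_I]-\mathbf F_s[\mathbf X_{s,t}\otimes e_I]\|_W\le C|t-s|^{(N-|I|)\alpha}\qquad(1)$$ (with $\mathbf X_{s,t}\otimes e_I$ truncated at level $N-1$). Let $\mathbf X,\tilde{\mathbf X}\in\mathscr C^\alpha([0,T];\mathbb R^d)$ satisfy $X^m=\tilde X^m$ for all $0\le m\le N-1$. Let $D\subseteq\Lambda$ and let $D\to\Lambda$, $\mathbf Y\mapsto\tilde{\mathbf Y}$,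 be a map such that, for every $s\in[0,T]$, $\mathbf X|_{[0,s]}\in D$ and $\mathbf X|_{[0,s]}\mapsto\tilde{\mathbf X}|_{[0,s]}$. Then: 1. $Sig(\tilde{\mathbf X})$ exists, is unique, and takes values in $\ell^2(\mathbb W_d)$. 2. The path $t\mapsto Sig(\tilde{\mathbf X})_{0,t}\in\ell^2(\mathbb W_d)$ is controlled by $\mathbf X$, i.e. it has a lift to an $\ell^2(\mathbb W_d)$-valued rough path controlled by $\mathbf X$. 3. $K(\mathbf Y,\mathbf Z)=K_{sig}(\tilde{\mathbf Y},\tilde{\mathbf Z})\,\mathrm{Id}_{\mathbb R^d}$ is a (symmetric, positive semidefinite) operator-valued kernel on $D$. If $\mathcal H_K$ is its reproducing kernel Hilbert space, the path $s\mapsto K(\mathbf X|_{[0,s]},\cdot)\in\mathcal L(\mathbb R^d;\mathcal H_K)$ has a lift $\boldsymbol K:[0,T]\to\mathcal L(T^{N-1}(\mathbb R^d);\mathcal L(\mathbb R^d;\mathcal H_K))$ that satisfies (1) and, for some $C$, all $s,t\in[0,T]$ and all $|I|\le N-1$, $$\|\boldsymbol K_t[e_I]-\boldsymbol K_s[e_I]\|_{\mathcal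 L(\mathbb R^d;\mathcal H_K)}\le C|t-s|^{\alpha},$$ and for which the rough integral $$\int_0^T K(\mathbf X|_{[0,t]},\cdot)\,\mathrm d\mathbf X_t=\lim_{|\mathcal P|\to0}\sum_{[s,t]\in\mathcal P}\ \sum_{|I|\le N-1}\ \sum_{k=1}^d\langle\mathbf X_{s,t},e_{Ik}\rangle\,(\boldsymbol K_s[e_I])[e_k]$$ exists in $\mathcal H_K$ (limit over partitions $\mathcal P$ of $[0,T]$ with mesh $|\mathcal P|\to0$). -/

import Mathlib

noncomputable section

/-- Formal tensor series `T((ℝ^d))` in coordinates: the coefficient of each word in the letters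
`0, …, d - 1`. -/
abbrev TSeries (d : ℕ) : Type := List (Fin d) → ℝ

/-- Truncated tensor algebra `T^(M)(ℝ^d)` in coordinates: one coefficient for each word of length
at most `M`. -/
abbrev TruncT (d M : ℕ) : Type := {I : List (Fin d) // I.length ≤ M} → ℝ

namespace TSeries

variable {d : ℕ}

/-- The basis tensor `e_I`; the unit `1` of the algebra is `word []`. -/
def word (I : List (Fin d)) : TSeries d := Pi.single I 1

/-- Tensor (concatenation) product:
the coefficient of `I` sums over all factorisations `I = I' ++ I''`. -/
def tmul (a b : TSeries d) : TSeries d := fun I =>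
  ∑ i ∈ Finset.range (I.length + 1), a (I.take i) * b (I.drop i)

/-- Projection onto `T^(M)(ℝ^d)`. -/
def trunc (M : ℕ) (a : TSeries d) : TruncT d M := fun I => a I.1

end TSeries

/-- The number of levels of an `α`-Hölder rough path, `⌊1/α⌋`. -/
def roughLevel (α : ℝ) : ℕ := ⌊1 / α⌋₊

/-- `α`-Hölder rough paths over `ℝ^d` on `[0, T]`: functions of `0 ≤ s ≤ t ≤ T` with values in
`T^(N)(ℝ^d)`, `N = ⌊1/α⌋`, which are `1` at level zero and satisfy Chen's relation and the Hölder
bounds. Values for other `(s, t)` and longer words are set to `0`, so that two rough paths are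
equal as soon as they agree where they are defined. -/
structure RoughPath (d : ℕ) (α T : ℝ) where
  toFun : ℝ → ℝ → TSeries d
  eq_zero : ∀ s t I, ¬ (0 ≤ s ∧ s ≤ t ∧ t ≤ T ∧ I.length ≤ roughLevel α) → toFun s t I = 0
  level_zero : ∀ s t, 0 ≤ s → s ≤ t → t ≤ T → toFun s t [] = 1
  chen : ∀ s u t, 0 ≤ s → s ≤ u → u ≤ t → t ≤ T → ∀ I : List (Fin d), I.length ≤ roughLevel α →
    toFun s t I = TSeries.tmul (toFun s u) (toFun u t) I
  holder : ∃ C : ℝ, ∀ s t, 0 ≤ s → s ≤ t → t ≤ T →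
    ∀ I : List (Fin d), I.length ≤ roughLevel α →
      |toFun s t I| ≤ C * (t - s) ^ ((I.length : ℝ) * α)

namespace RoughPath

variable {d : ℕ} {α T : ℝ}

/-- Restriction of a rough path to `[0, r]`, for `r ≤ T`. -/
def restrict (X : RoughPath d α T) (r : ℝ) (hr : r ≤ T) : RoughPath d α r where
  toFun s t I := if t ≤ r then X.toFun s t I else 0
  eq_zero s t I h := by
    split_ifs with htr
    · exact X.eq_zero s t I fun h' => h ⟨h'.1, h'.2.1, htr, h'.2.2.2⟩
    · rfl
  level_zero s t h0 hst htr := by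
    simp only [htr, if_true]
    exact X.level_zero s t h0 hst (htr.trans hr)
  chen s u t h0 hsu hut htr I hI := by
    have hur : u ≤ r := hut.trans htr
    simp only [htr, hur, if_true]
    exact X.chen s u t h0 hsu hut (htr.trans hr) I hI
  holder := by
    obtain ⟨C, hC⟩ := X.holder
    refine ⟨C, fun s t h0 hst htr I hI => ?_⟩
    simp only [htr, if_true]
    exact hC s t h0 hst (htr.trans hr) I hI

/-- `S` is a signature of `X`: a multiplicative extension of `X` to all words with
`|S_{s,t}^I| ≤ C_{|I|} |t-s|^{|I| α}` (normalised to be `0` unless `0 ≤ s ≤ t ≤ T`). -/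
structure IsSignature (X : RoughPath d α T) (S : ℝ → ℝ → TSeries d) : Prop where
  eq_zero : ∀ s t I, ¬ (0 ≤ s ∧ s ≤ t ∧ t ≤ T) → S s t I = 0
  extend : ∀ s t, 0 ≤ s → s ≤ t → t ≤ T →
    ∀ I : List (Fin d), I.length ≤ roughLevel α → S s t I = X.toFun s t I
  chen : ∀ s u t, 0 ≤ s → s ≤ u → u ≤ t → t ≤ T → S s t = TSeries.tmul (S s u) (S u t)
  bound : ∀ n : ℕ, ∃ C : ℝ, ∀ s t, 0 ≤ s → s ≤ t → t ≤ T →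
    ∀ I : List (Fin d), I.length = n → |S s t I| ≤ C * (t - s) ^ ((n : ℝ) * α)

/-- The signature of a rough path, i.e. the `S` with `X.IsSignature S`. -/
def sig (X : RoughPath d α T) : ℝ → ℝ → TSeries d := Classical.epsilon X.IsSignature

end RoughPath

/-- The set of histories `⋃_{t ∈ [0, T]} 𝒞^α([0, t]; ℝ^d)`. -/
abbrev History (d : ℕ) (α T : ℝ) : Type := Σ t : Set.Icc (0 : ℝ) T, RoughPath d α t

/-- The history `X|_{[0, t]}` of a rough path on `[0, T]`. -/
def RoughPath.history {d : ℕ} {α T : ℝ} (X : RoughPath d α T) (t : Set.Icc (0 : ℝ) T) :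
    History d α T := ⟨t, X.restrict t t.2.2⟩

/-- The real signature kernel: the `ℓ²` inner product of the signatures of `Y` and `Z`, each over
its whole interval. -/
def sigKernel {d : ℕ} {α T : ℝ} (Y Z : History d α T) : ℝ :=
  ∑' I : List (Fin d), Y.2.sig 0 Y.1 I * Z.2.sig 0 Z.1 I

/-- The operator-valued kernel `K(Y, Z) = K_sig(Ỹ, Z̃) Id`, where `Y ↦ Ỹ` is the map `tilde`. -/
def tildeSigKernel {d : ℕ} {α T : ℝ} {D : Set (History d α T)} (tilde : D → History d α T) :
    Matrix D D (EuclideanSpace ℝ (Fin d) →L[ℝ] EuclideanSpace ℝ (Fin d)) :=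
  .of fun Y Z => sigKernel (tilde Y) (tilde Z) • ContinuousLinearMap.id ℝ _

section Controlled

variable {d : ℕ} {α T : ℝ} {W : Type*} [NormedAddCommGroup W] [NormedSpace ℝ W]

/-- `Y : [0, T] → L(T^(N-1)(ℝ^d); W)` is a `W`-valued rough path controlled by `X`:
`‖⟨Y_t, e_I⟩ - ⟨Y_s, X_{s,t} ⊗ e_I⟩‖ ≤ C |t-s|^{(N-|I|)α}` for all `|I| ≤ N - 1`. -/
def IsControlledBy (X : RoughPath d α T)
    (Y : Set.Icc (0 : ℝ) T → TruncT d (roughLevel α - 1) →ₗ[ℝ] W) : Prop :=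
  ∃ C : ℝ, ∀ s t : Set.Icc (0 : ℝ) T, s ≤ t → ∀ I : List (Fin d), I.length ≤ roughLevel α - 1 →
    ‖Y t (TSeries.trunc _ (TSeries.word I)) -
      Y s (TSeries.trunc _ (TSeries.tmul (X.toFun s t) (TSeries.word I)))‖
      ≤ C * ((t : ℝ) - s) ^ (((roughLevel α : ℝ) - I.length) * α)

/-- `Y` is `α`-Hölder in each component. -/
def IsHolderLift (α : ℝ) (Y : Set.Icc (0 : ℝ) T → TruncT d (roughLevel α - 1) →ₗ[ℝ] W) : Prop :=
  ∃ C : ℝ, ∀ s t : Set.Icc (0 : ℝ) T, ∀ I : List (Fin d), I.length ≤ roughLevel α - 1 →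
    ‖Y t (TSeries.trunc _ (TSeries.word I)) - Y s (TSeries.trunc _ (TSeries.word I))‖
      ≤ C * |(t : ℝ) - s| ^ α

/-- `Y` lifts the `W`-valued path `Y₀`. -/
def Lifts (Y : Set.Icc (0 : ℝ) T → TruncT d (roughLevel α - 1) →ₗ[ℝ] W)
    (Y₀ : Set.Icc (0 : ℝ) T → W) : Prop :=
  ∀ t, Y t (TSeries.trunc _ (TSeries.word [])) = Y₀ t

end Controlled

section Integral

variable {d : ℕ} {α T : ℝ} {H : Type*} [NormedAddCommGroup H] [NormedSpace ℝ H]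

/-- The compensated increment `∑_{|I| ≤ N-1} ∑_k X^{Ik}_{s,t} (K_s[e_I])[e_k]`; the words of
length `m` are `List.ofFn I` for `I : Fin m → Fin d`. -/
def compensatedIncrement (X : RoughPath d α T)
    (K : Set.Icc (0 : ℝ) T → TruncT d (roughLevel α - 1) →ₗ[ℝ] (EuclideanSpace ℝ (Fin d) →L[ℝ] H))
    (s t : Set.Icc (0 : ℝ) T) : H :=
  ∑ m ∈ Finset.range (roughLevel α), ∑ I : Fin m → Fin d, ∑ k : Fin d,
    X.toFun s t (List.ofFn I ++ [k]) •
      K s (TSeries.trunc _ (TSeries.word (List.ofFn I))) (EuclideanSpace.single k 1)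

/-- `Φ = ∫_0^T K dX`: `Φ` is the limit of the compensated Riemann sums over the partitions
`0 = τ_0 ≤ ⋯ ≤ τ_n = T` as their mesh tends to zero. -/
def IsRoughIntegral (X : RoughPath d α T)
    (K : Set.Icc (0 : ℝ) T → TruncT d (roughLevel α - 1) →ₗ[ℝ] (EuclideanSpace ℝ (Fin d) →L[ℝ] H))
    (Φ : H) : Prop :=
  ∀ ε > 0, ∃ δ > 0, ∀ (n : ℕ) (τ : Fin (n + 1) → Set.Icc (0 : ℝ) T), Monotone τ →
    (τ 0 : ℝ) = 0 → (τ (Fin.last n) : ℝ) = T →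
    (∀ i : Fin n, (τ i.succ : ℝ) - τ i.castSucc < δ) →
    ‖∑ i : Fin n, compensatedIncrement X K (τ i.castSucc) (τ i.succ) - Φ‖ < ε

end Integral

end

/-! Write `S` for the signature of `X̃`. The path `S_{0,t}` is lifted by left multiplication,
`Y_t[b] = S_{0,t} ⊗ b`. By Chen's relation `Y_t[e_I] - Y_s[X_{s,t} ⊗ e_I] = S_{0,s} ⊗ R ⊗ e_I`,
where `R` is the part of `S_{s,t}` at levels at least `N - |I|`: truncation at level `N - 1` keeps
only levels of `X_{s,t}` on which `X` and `X̃` agree. Being controlled thus reduces to two bounds: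
`S_{0,s}` is bounded, and the part of `S_{s,t}` at levels at least `m` is of order `|t-s|^{mα}`.

Both are proved in `ℓ¹`, which is submultiplicative for concatenation and embeds in `ℓ²`. Geometric
growth of the coefficients suffices, without factorial decay (`IsSignature.exists_geometric_bound`):
on short intervals the tail is a convergent geometric series, and Chen's relation carries
boundedness to long ones (`IsSignature.exists_l1_tail_le`).

The signature is built one level at a time (`IsExtension.exists_succ`). Above level `N`, Chen's
relation prescribes the additive defect of each coefficient; its order exceeds `1`, so sewing
produces the coefficient. It is unique because an additive function of order above `1` vanishes.

The kernel is a Gram matrix in `ℓ²` times the identity, so sending the signature of `Ỹ` to the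
kernel function at `Y` extends to a bounded operator from `ℓ²` (`exists_clm_sigLp_eq_kerFun`).
Composing the lift with it preserves all estimates, and controlled paths are integrated by sewing.
-/

noncomputable section

/-! ### Sewing of almost additive functions -/

section Sewing

open Filter Topology

variable {E : Type*} [NormedAddCommGroup E]

lemma two_rpow_one_sub_pos (θ : ℝ) : (0 : ℝ) < 2 ^ (1 - θ) := by positivity

lemma two_rpow_one_sub_lt_one {θ : ℝ} (hθ : 1 < θ) : (2 : ℝ) ^ (1 - θ) < 1 :=
  Real.rpow_lt_one_of_one_lt_of_neg (by norm_num) (by linarith)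

lemma two_mul_half_rpow {x : ℝ} (hx : 0 ≤ x) (θ : ℝ) :
    2 * (x / 2) ^ θ = 2 ^ (1 - θ) * x ^ θ := by
  rw [Real.div_rpow hx (by norm_num), Real.rpow_sub (by norm_num), Real.rpow_one]
  ring

/-- A two-parameter function that is additive at midpoints up to `c (t - s)^θ` inherits a bound
with an explicit constant from any a priori bound. -/
lemma norm_le_of_midpoint {T θ K c : ℝ} (hθ : 1 < θ) {R : ℝ → ℝ → E}
    (hK : ∀ s t, 0 ≤ s → s ≤ t → t ≤ T → ‖R s t‖ ≤ K * (t - s) ^ θ)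
    (hR : ∀ s t, 0 ≤ s → s ≤ t → t ≤ T →
      ‖R s t - R s ((s + t) / 2) - R ((s + t) / 2) t‖ ≤ c * (t - s) ^ θ)
    {s t : ℝ} (hs : 0 ≤ s) (hst : s ≤ t) (ht : t ≤ T) :
    ‖R s t‖ ≤ c / (1 - 2 ^ (1 - θ)) * (t - s) ^ θ := by
  set r : ℝ := 2 ^ (1 - θ) with hr
  have hr0 : 0 < r := two_rpow_one_sub_pos θ
  have hr1 : r < 1 := two_rpow_one_sub_lt_one hθ
  -- Halving the interval turns a valid constant `A` into `r * A + c`; the distance to the fixed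
  -- point `c / (1 - r)` shrinks by `r` each time.
  have key : ∀ n : ℕ, ∀ s t, 0 ≤ s → s ≤ t → t ≤ T →
      ‖R s t‖ ≤ ((K - c / (1 - r)) * r ^ n + c / (1 - r)) * (t - s) ^ θ := by
    intro n
    induction n with
    | zero => intro s t hs hst ht; simpa using hK s t hs hst ht
    | succ n ih =>
      intro s t hs hst ht
      have h1 := ih s ((s + t) / 2) hs (by linarith) (by linarith)
      have h2 := ih ((s + t) / 2) t (by linarith) (by linarith) ht
      have h3 := hR s t hs hst ht
      have e1 : (s + t) / 2 - s = (t - s) / 2 := by ring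
      have e2 : t - (s + t) / 2 = (t - s) / 2 := by ring
      rw [e1] at h1
      rw [e2] at h2
      have h4 := two_mul_half_rpow (x := t - s) (by linarith) θ
      rw [← hr] at h4
      calc ‖R s t‖ = ‖(R s t - R s ((s + t) / 2) - R ((s + t) / 2) t) + R s ((s + t) / 2)
            + R ((s + t) / 2) t‖ := by congr 1; abel
        _ ≤ ‖R s t - R s ((s + t) / 2) - R ((s + t) / 2) t‖ + ‖R s ((s + t) / 2)‖
            + ‖R ((s + t) / 2) t‖ := norm_add₃_le
        _ ≤ c * (t - s) ^ θ + ((K - c / (1 - r)) * r ^ n + c / (1 - r)) * (2 * ((t - s) / 2) ^ θ)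
            := by linarith
        _ = _ := by
          have : 1 - r ≠ 0 := by linarith
          rw [h4]; field_simp; ring
  have hlim : Tendsto (fun n : ℕ => ((K - c / (1 - r)) * r ^ n + c / (1 - r)) * (t - s) ^ θ)
      atTop (𝓝 (((K - c / (1 - r)) * 0 + c / (1 - r)) * (t - s) ^ θ)) :=
    (((tendsto_pow_atTop_nhds_zero_of_lt_one hr0.le hr1).const_mul _).add_const _).mul_const _
  rw [mul_zero, zero_add] at hlim
  exact ge_of_tendsto' hlim fun n => key n s t hs hst ht

lemma apply_self_eq_zero_of_sewing {T θ C : ℝ} (hθ : 1 < θ) {Ξ : ℝ → ℝ → E}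
    (hΞ : ∀ s u t, 0 ≤ s → s ≤ u → u ≤ t → t ≤ T →
      ‖Ξ s t - Ξ s u - Ξ u t‖ ≤ C * (t - s) ^ θ) {s : ℝ} (hs : 0 ≤ s) (hT : s ≤ T) :
    Ξ s s = 0 := by
  have := hΞ s s s hs le_rfl le_rfl hT
  rw [sub_self, sub_self, Real.zero_rpow (by linarith), mul_zero] at this
  simpa using this

/-- Maximal inequality: every Riemann sum of an almost additive function is close to its value on
the whole interval. -/
lemma norm_sum_sub_le_of_sewing {T θ C : ℝ} (hθ : 1 < θ) (hC : 0 ≤ C) {Ξ : ℝ → ℝ → E}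
    (hΞ : ∀ s u t, 0 ≤ s → s ≤ u → u ≤ t → t ≤ T →
      ‖Ξ s t - Ξ s u - Ξ u t‖ ≤ C * (t - s) ^ θ) (n : ℕ) :
    ∀ x : ℕ → ℝ, Monotone x → 0 ≤ x 0 → x n ≤ T →
      ‖∑ i ∈ Finset.range n, Ξ (x i) (x (i + 1)) - Ξ (x 0) (x n)‖
        ≤ 2 * C / (1 - 2 ^ (1 - θ)) * (x n - x 0) ^ θ := by
  set r : ℝ := 2 ^ (1 - θ) with hr
  have hr1 : r < 1 := two_rpow_one_sub_lt_one hθ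
  -- The fixed point of `K ↦ K * r + 2 * C`: the two outer pieces cost `K * r`, splitting off the
  -- middle cell costs `C` twice.
  set K := 2 * C / (1 - r) with hKdef
  have hK0 : 0 ≤ K := div_nonneg (by linarith) (by linarith)
  have hK : K * r + 2 * C = K := by
    have : 1 - r ≠ 0 := by linarith
    rw [hKdef]; field_simp; ring
  induction n using Nat.strong_induction_on with
  | _ n ih =>
    intro x hx h0 hn
    rcases Nat.eq_zero_or_pos n with rfl | hpos
    · simp [apply_self_eq_zero_of_sewing hθ hΞ h0 hn, Real.zero_rpow (by linarith : θ ≠ 0)]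
    have hL : 0 ≤ x n - x 0 := sub_nonneg.2 (hx (Nat.zero_le n))
    -- The cell from `x j` to `x (j + 1)` contains the midpoint, so what remains on either side is
    -- at most half as long.
    obtain ⟨j, hjn, hj, hj'⟩ : ∃ j < n, x j - x 0 ≤ (x n - x 0) / 2 ∧
        x n - x (j + 1) ≤ (x n - x 0) / 2 := by
      by_contra! hcon
      have : ∀ j ≤ n, x j - x 0 ≤ (x n - x 0) / 2 := by
        intro j
        induction j with
        | zero => intro _; simp only [sub_self]; linarith
        | succ j ihj =>
          intro hj
          have := hcon j (by omega) (ihj (by omega))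
          linarith
      have h1 := this (n - 1) (by omega)
      have h2 := hcon (n - 1) (by omega) h1
      rw [Nat.sub_add_cancel hpos] at h2
      linarith
    have hj1 : x (j + 1) ≤ x n := hx (by omega)
    have hj0 : x 0 ≤ x j := hx (Nat.zero_le j)
    have hjj : x j ≤ x (j + 1) := hx (Nat.le_succ j)
    have I1 := ih j hjn x hx h0 (by linarith)
    have I2 := ih (n - (j + 1)) (by omega) (fun i => x (j + 1 + i))
      (fun a b hab => hx (by omega)) (by simpa using by linarith)
      (by rwa [Nat.add_sub_cancel' (by omega)])
    simp only [add_zero, Nat.add_sub_cancel' (show j + 1 ≤ n by omega), ← add_assoc] at I2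
    have D1 := hΞ (x 0) (x j) (x (j + 1)) h0 hj0 hjj (by linarith)
    have D2 := hΞ (x 0) (x (j + 1)) (x n) h0 (by linarith) hj1 hn
    have hmono1 : (x j - x 0) ^ θ ≤ ((x n - x 0) / 2) ^ θ :=
      Real.rpow_le_rpow (by linarith) hj (by linarith)
    have hmono2 : (x n - x (j + 1)) ^ θ ≤ ((x n - x 0) / 2) ^ θ :=
      Real.rpow_le_rpow (by linarith) hj' (by linarith)
    have hmono3 : (x (j + 1) - x 0) ^ θ ≤ (x n - x 0) ^ θ :=
      Real.rpow_le_rpow (by linarith) (by linarith) (by linarith)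
    have hsum : ∑ i ∈ Finset.range n, Ξ (x i) (x (i + 1)) =
        ∑ i ∈ Finset.range j, Ξ (x i) (x (i + 1)) + Ξ (x j) (x (j + 1)) +
          ∑ i ∈ Finset.range (n - (j + 1)), Ξ (x (j + 1 + i)) (x (j + 1 + i + 1)) := by
      rw [← Finset.sum_range_succ, ← Finset.sum_range_add,
        Nat.add_sub_cancel' (show j + 1 ≤ n by omega)]
    have h4 := two_mul_half_rpow hL θ
    rw [← hr] at h4
    rw [hsum]
    calc _ = ‖(∑ i ∈ Finset.range j, Ξ (x i) (x (i + 1)) - Ξ (x 0) (x j)) +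
          (∑ i ∈ Finset.range (n - (j + 1)), Ξ (x (j + 1 + i)) (x (j + 1 + i + 1))
            - Ξ (x (j + 1)) (x n)) - (Ξ (x 0) (x (j + 1)) - Ξ (x 0) (x j) - Ξ (x j) (x (j + 1)))
          - (Ξ (x 0) (x n) - Ξ (x 0) (x (j + 1)) - Ξ (x (j + 1)) (x n))‖ := by
            congr 1; abel
      _ ≤ K * (x j - x 0) ^ θ + K * (x n - x (j + 1)) ^ θ + C * (x (j + 1) - x 0) ^ θ
          + C * (x n - x 0) ^ θ := by
            refine (norm_sub_le _ _).trans (add_le_add ((norm_sub_le _ _).trans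
              (add_le_add ((norm_add_le _ _).trans (add_le_add I1 I2)) D1)) D2)
      _ ≤ K * ((x n - x 0) / 2) ^ θ + K * ((x n - x 0) / 2) ^ θ + C * (x n - x 0) ^ θ
          + C * (x n - x 0) ^ θ := by gcongr
      _ = (K * r + 2 * C) * (x n - x 0) ^ θ := by linear_combination K * h4
      _ = _ := by rw [hK]

/-- The Riemann sum of `Ξ` over the trace on `[s, t]` of the `n`-th dyadic partition
of `[0, T]`. -/
def dyadicSum (Ξ : ℝ → ℝ → E) (T : ℝ) (n : ℕ) (s t : ℝ) : E :=
  ∑ k ∈ Finset.range (2 ^ n), Ξ (max s (min t (k * (T / 2 ^ n))))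
    (max s (min t ((k + 1 : ℕ) * (T / 2 ^ n))))

/-- The power `θ - 1` is spent on the mesh and the remaining first power telescopes. This makes
defects disappear as the mesh shrinks. -/
lemma norm_sum_le_of_norm_le_rpow {θ C h : ℝ} (hθ : 1 < θ) (hC : 0 ≤ C) {n : ℕ} {x : ℕ → ℝ}
    (hx : Monotone x) (hxh : ∀ k, x (k + 1) - x k ≤ h) {v : ℕ → E}
    (hv : ∀ k, ‖v k‖ ≤ C * (x (k + 1) - x k) ^ θ) :
    ‖∑ k ∈ Finset.range n, v k‖ ≤ C * h ^ (θ - 1) * (x n - x 0) := by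
  rw [← Finset.sum_range_sub, Finset.mul_sum]
  refine norm_sum_le_of_le _ fun k _ => (hv k).trans ?_
  have h0 : 0 ≤ x (k + 1) - x k := sub_nonneg.2 (hx k.le_succ)
  rw [mul_assoc]
  refine mul_le_mul_of_nonneg_left ?_ hC
  calc (x (k + 1) - x k) ^ θ = (x (k + 1) - x k) ^ (θ - 1) * (x (k + 1) - x k) := by
        rcases h0.eq_or_lt with h | h
        · rw [← h, Real.zero_rpow (by linarith), mul_zero]
        · rw [Real.rpow_sub_one h.ne', div_mul_cancel₀ _ h.ne']
    _ ≤ _ := mul_le_mul_of_nonneg_right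
        (Real.rpow_le_rpow h0 (hxh k) (by linarith)) h0

lemma clamp_sub_clamp_le {s t a b : ℝ} (hab : a ≤ b) :
    max s (min t b) - max s (min t a) ≤ b - a := by
  rcases max_cases s (min t b) with h | h <;> rcases max_cases s (min t a) with h' | h' <;>
  rcases min_cases t b with h'' | h'' <;> rcases min_cases t a with h''' | h''' <;> linarith

/-- Sewing lemma. -/
theorem exists_sewing [CompleteSpace E] {T θ C : ℝ} (hT : 0 ≤ T) (hθ : 1 < θ) (hC : 0 ≤ C)
    {Ξ : ℝ → ℝ → E}
    (hΞ : ∀ s u t, 0 ≤ s → s ≤ u → u ≤ t → t ≤ T →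
      ‖Ξ s t - Ξ s u - Ξ u t‖ ≤ C * (t - s) ^ θ) :
    ∃ I : ℝ → ℝ → E,
      (∀ s u t, 0 ≤ s → s ≤ u → u ≤ t → t ≤ T → I s t = I s u + I u t) ∧
      ∀ s t, 0 ≤ s → s ≤ t → t ≤ T →
        ‖I s t - Ξ s t‖ ≤ 2 * C / (1 - 2 ^ (1 - θ)) * (t - s) ^ θ := by
  have hstep : ∀ n : ℕ, 0 ≤ T / 2 ^ n := fun n => by positivity
  have hgrid : ∀ (n : ℕ) (s t : ℝ),
      Monotone fun k : ℕ => max s (min t ((k : ℝ) * (T / 2 ^ n))) := by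
    intro n s t a b hab
    have : (a : ℝ) ≤ b := by exact_mod_cast hab
    exact max_le_max le_rfl (min_le_min le_rfl (mul_le_mul_of_nonneg_right this (hstep n)))
  have hmesh : ∀ (n : ℕ) (s t : ℝ) (k : ℕ), max s (min t (((k + 1 : ℕ) : ℝ) * (T / 2 ^ n))) -
      max s (min t ((k : ℝ) * (T / 2 ^ n))) ≤ T / 2 ^ n := by
    intro n s t k
    refine (clamp_sub_clamp_le ?_).trans_eq ?_
    · exact mul_le_mul_of_nonneg_right (by push_cast; linarith) (hstep n)
    · push_cast; ring
  have hfirst : ∀ (n : ℕ) {s t : ℝ}, 0 ≤ s → s ≤ t →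
      max s (min t (((0 : ℕ) : ℝ) * (T / 2 ^ n))) = s := by
    intro n s t hs hst
    rw [Nat.cast_zero, zero_mul, min_eq_right (hs.trans hst), max_eq_left hs]
  have hlast : ∀ (n : ℕ) {s t : ℝ}, s ≤ t → t ≤ T →
      max s (min t (((2 ^ n : ℕ) : ℝ) * (T / 2 ^ n))) = t := by
    intro n s t hst ht
    have : ((2 ^ n : ℕ) : ℝ) * (T / 2 ^ n) = T := by
      push_cast; field_simp
    rw [this, min_eq_left ht, max_eq_right hst]
  have hrange : ∀ {s t : ℝ} (y : ℝ), s ≤ t → s ≤ max s (min t y) ∧ max s (min t y) ≤ t :=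
    fun y hst => ⟨le_max_left _ _, max_le hst (min_le_left _ _)⟩
  have hrefine : ∀ (n : ℕ) (s t : ℝ), 0 ≤ s → s ≤ t → t ≤ T →
      ‖dyadicSum Ξ T n s t - dyadicSum Ξ T (n + 1) s t‖
        ≤ C * (T / 2 ^ n) ^ (θ - 1) * (t - s) := by
    intro n s t hs hst ht
    have hev : ∀ m : ℕ, ∀ f : ℕ → E, ∑ k ∈ Finset.range (2 * m), f k =
        ∑ k ∈ Finset.range m, (f (2 * k) + f (2 * k + 1)) := by
      intro m f
      induction m with
      | zero => simp
      | succ m ih =>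
        rw [mul_add, mul_one, Finset.sum_range_succ, Finset.sum_range_succ, ih,
          Finset.sum_range_succ, add_assoc]
    have hb := norm_sum_le_of_norm_le_rpow (n := 2 ^ n) hθ hC (hgrid n s t) (hmesh n s t)
      (v := fun k => Ξ (max s (min t (k * (T / 2 ^ n))))
          (max s (min t ((k + 1 : ℕ) * (T / 2 ^ n)))) -
        (Ξ (max s (min t ((2 * k : ℕ) * (T / 2 ^ (n + 1)))))
          (max s (min t ((2 * k + 1 : ℕ) * (T / 2 ^ (n + 1))))) +
        Ξ (max s (min t ((2 * k + 1 : ℕ) * (T / 2 ^ (n + 1)))))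
          (max s (min t ((2 * k + 1 + 1 : ℕ) * (T / 2 ^ (n + 1))))))) ?_
    · rw [hfirst n hs hst, hlast n hst ht, Finset.sum_sub_distrib] at hb
      rw [dyadicSum, dyadicSum, pow_succ' 2 n, hev]
      exact hb
    · intro k
      have e1 : ((2 * k : ℕ) : ℝ) * (T / 2 ^ (n + 1)) = k * (T / 2 ^ n) := by
        push_cast; field_simp; ring
      have e2 : ((2 * k + 1 + 1 : ℕ) : ℝ) * (T / 2 ^ (n + 1)) = (k + 1 : ℕ) * (T / 2 ^ n) := by
        push_cast; field_simp; ring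
      have m1 := hgrid (n + 1) s t (show 2 * k ≤ 2 * k + 1 by omega)
      have m2 := hgrid (n + 1) s t (show 2 * k + 1 ≤ 2 * k + 1 + 1 by omega)
      simp only [e1] at m1
      simp only [e2] at m2
      rw [e1, e2, ← sub_sub]
      exact hΞ _ _ _ (hs.trans (hrange _ hst).1) m1 m2 ((hrange _ hst).2.trans ht)
  have hpow : ∀ n : ℕ, (T / 2 ^ n) ^ (θ - 1) = T ^ (θ - 1) * ((2 : ℝ) ^ (1 - θ)) ^ n := by
    intro n
    rw [Real.div_rpow hT (by positivity), ← Real.rpow_natCast, ← Real.rpow_natCast,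
      ← Real.rpow_mul (by norm_num), ← Real.rpow_mul (by norm_num), div_eq_mul_inv,
      ← Real.rpow_neg (by norm_num)]
    ring_nf
  have hlim : ∀ s t, ∃ L : E, 0 ≤ s → s ≤ t → t ≤ T →
      Tendsto (fun n => dyadicSum Ξ T n s t) atTop (𝓝 L) := by
    intro s t
    by_cases h : 0 ≤ s ∧ s ≤ t ∧ t ≤ T
    · have : CauchySeq fun n => dyadicSum Ξ T n s t := by
        refine cauchySeq_of_le_geometric (2 ^ (1 - θ)) (C * T ^ (θ - 1) * (t - s))
          (two_rpow_one_sub_lt_one hθ) fun n => ?_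
        rw [dist_eq_norm]
        refine (hrefine n s t h.1 h.2.1 h.2.2).trans_eq ?_
        rw [hpow]; ring
      obtain ⟨L, hL⟩ := cauchySeq_tendsto_of_complete this
      exact ⟨L, fun _ _ _ => hL⟩
    · exact ⟨0, fun h1 h2 h3 => absurd ⟨h1, h2, h3⟩ h⟩
  choose I hI using hlim
  refine ⟨I, fun s u t hs hsu hut ht => ?_, fun s t hs hst ht => ?_⟩
  · have hst := hsu.trans hut
    have hbound : ∀ n, ‖dyadicSum Ξ T n s t - (dyadicSum Ξ T n s u + dyadicSum Ξ T n u t)‖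
        ≤ C * T ^ (θ - 1) * (t - s) * ((2 : ℝ) ^ (1 - θ)) ^ n := by
      intro n
      have hb := norm_sum_le_of_norm_le_rpow (n := 2 ^ n) hθ hC (hgrid n s t) (hmesh n s t)
        (v := fun k => Ξ (max s (min t (k * (T / 2 ^ n))))
            (max s (min t ((k + 1 : ℕ) * (T / 2 ^ n)))) -
          (Ξ (max s (min u (k * (T / 2 ^ n))))
            (max s (min u ((k + 1 : ℕ) * (T / 2 ^ n)))) +
          Ξ (max u (min t (k * (T / 2 ^ n))))
            (max u (min t ((k + 1 : ℕ) * (T / 2 ^ n)))))) ?_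
      · rw [hfirst n hs hst, hlast n hst ht, Finset.sum_sub_distrib, Finset.sum_add_distrib] at hb
        refine hb.trans_eq ?_
        rw [hpow]; ring
      · intro k
        have hab := hgrid n s t k.le_succ
        simp only [Nat.succ_eq_add_one] at hab
        set y := (k : ℝ) * (T / 2 ^ n)
        set z := ((k + 1 : ℕ) : ℝ) * (T / 2 ^ n)
        have hyz : y ≤ z := mul_le_mul_of_nonneg_right (by push_cast; linarith) (hstep n)
        have hu0 := apply_self_eq_zero_of_sewing hθ hΞ (hs.trans hsu) (hut.trans ht)
        have hnn : 0 ≤ C * (max s (min t z) - max s (min t y)) ^ θ :=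
          mul_nonneg hC (Real.rpow_nonneg (sub_nonneg.2 hab) _)
        -- A cell on one side of `u` has no defect, since its degenerate part contributes `Ξ u u =
        -- 0`. Only a cell straddling `u` needs `hΞ`.
        rcases le_total z u with hzu | huz
        · have h1 : min t z = z := min_eq_right (hzu.trans hut)
          have h2 : min t y = y := min_eq_right (hyz.trans (hzu.trans hut))
          rw [h1, h2] at hnn ⊢
          rw [min_eq_right hzu, min_eq_right (hyz.trans hzu), max_eq_left hzu,
            max_eq_left (hyz.trans hzu), hu0]
          simpa using hnn
        rcases le_total u y with huy | hyu
        · have e : ∀ w, u ≤ w → max s (min t w) = max u (min t w) := by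
            intro w hw
            rw [max_eq_right (hsu.trans (le_min hut hw)), max_eq_right (le_min hut hw)]
          rw [e z huz, e y huy] at hnn ⊢
          rw [min_eq_left huz, min_eq_left huy, max_eq_right hsu, hu0]
          simpa using hnn
        · have e1 : max s (min t y) = max s (min u y) := by
            rw [min_eq_right hyu, min_eq_right (hyu.trans hut)]
          have e2 : max s (min t z) = max u (min t z) := by
            rw [max_eq_right (hsu.trans (le_min hut huz)), max_eq_right (le_min hut huz)]
          have e3 : max s (min u z) = u := by rw [min_eq_left huz, max_eq_right hsu]
          have e4 : max u (min t y) = u := by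
            rw [min_eq_right (hyu.trans hut), max_eq_left hyu]
          rw [e1, e2, e3, e4, ← sub_sub]
          exact hΞ _ _ _ (hs.trans (le_max_left _ _)) (hrange _ hsu).2 (le_max_left _ _)
            ((hrange _ hut).2.trans ht)
    have h0 : Tendsto (fun n : ℕ => C * T ^ (θ - 1) * (t - s) * ((2 : ℝ) ^ (1 - θ)) ^ n)
        atTop (𝓝 0) := by
      simpa using (tendsto_pow_atTop_nhds_zero_of_lt_one (two_rpow_one_sub_pos θ).le
        (two_rpow_one_sub_lt_one hθ)).const_mul (C * T ^ (θ - 1) * (t - s))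
    exact sub_eq_zero.1 (tendsto_nhds_unique
      ((hI s t hs hst ht).sub ((hI s u hs hsu (hut.trans ht)).add
        (hI u t (hs.trans hsu) hut ht))) (squeeze_zero_norm hbound h0))
  · refine le_of_tendsto ((hI s t hs hst ht).sub_const (Ξ s t)).norm (Eventually.of_forall ?_)
    intro n
    have := norm_sum_sub_le_of_sewing hθ hC hΞ (2 ^ n) _ (hgrid n s t)
      (by rw [hfirst n hs hst]; exact hs) (by rwa [hlast n hst ht])
    simp only [hfirst n hs hst, hlast n hst ht] at this
    exact this

/-- Sewing lemma for cocycles. -/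
theorem exists_sewing_of_cocycle [CompleteSpace E] {T θ C : ℝ} (hT : 0 ≤ T) (hθ : 1 < θ)
    (hC : 0 ≤ C) {g : ℝ → ℝ → ℝ → E}
    (hg : ∀ s u t, 0 ≤ s → s ≤ u → u ≤ t → t ≤ T → ‖g s u t‖ ≤ C * (t - s) ^ θ)
    (hcoc : ∀ s u t, 0 ≤ s → s ≤ u → u ≤ t → t ≤ T →
      g 0 s t + g s u t = g 0 u t + g 0 s u) :
    ∃ R : ℝ → ℝ → E,
      (∀ s u t, 0 ≤ s → s ≤ u → u ≤ t → t ≤ T → R s t = R s u + R u t + g s u t) ∧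
      ∀ s t, 0 ≤ s → s ≤ t → t ≤ T →
        ‖R s t‖ ≤ 2 * C / (1 - 2 ^ (1 - θ)) * (t - s) ^ θ := by
  -- By the cocycle identity `g 0` has additive defect `-g s u t`, so its sewing minus `g 0` has
  -- defect `g`.
  obtain ⟨I, hadd, hI⟩ := exists_sewing (Ξ := fun s t => g 0 s t) hT hθ hC (by
    intro s u t hs hsu hut ht
    have : g 0 s t - g 0 s u - g 0 u t = -g s u t := by
      rw [eq_sub_of_add_eq (hcoc s u t hs hsu hut ht)]
      abel
    rw [this, norm_neg]
    exact hg s u t hs hsu hut ht)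
  refine ⟨fun s t => I s t - g 0 s t, fun s u t hs hsu hut ht => ?_, hI⟩
  have h1 := hadd s u t hs hsu hut ht
  have h2 := hcoc s u t hs hsu hut ht
  have h3 : g s u t = g 0 u t + g 0 s u - g 0 s t := by rw [← h2]; abel
  simp only [h1, h3]
  abel

/-- Riemann sums of an almost additive function converge to the increments of its sewing. -/
theorem exists_limit_sum_of_sewing [CompleteSpace E] {T θ C : ℝ} (hT : 0 ≤ T) (hθ : 1 < θ)
    (hC : 0 ≤ C) {Ξ : ℝ → ℝ → E}
    (hΞ : ∀ s u t, 0 ≤ s → s ≤ u → u ≤ t → t ≤ T →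
      ‖Ξ s t - Ξ s u - Ξ u t‖ ≤ C * (t - s) ^ θ) :
    ∃ Φ : E, ∀ ε > 0, ∃ δ > 0, ∀ (n : ℕ) (τ : ℕ → ℝ), Monotone τ → τ 0 = 0 → τ n = T →
      (∀ i < n, τ (i + 1) - τ i < δ) →
      ‖∑ i ∈ Finset.range n, Ξ (τ i) (τ (i + 1)) - Φ‖ < ε := by
  obtain ⟨I, hadd, hI⟩ := exists_sewing hT hθ hC hΞ
  set K := 2 * C / (1 - 2 ^ (1 - θ)) with hKdef
  have hK : 0 ≤ K :=
    div_nonneg (by linarith) (by linarith [two_rpow_one_sub_lt_one hθ])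
  refine ⟨I 0 T, fun ε hε => ?_⟩
  have hcont : Tendsto (fun δ : ℝ => K * δ ^ (θ - 1) * T) (𝓝[>] 0) (𝓝 0) := by
    have : ContinuousAt (fun δ : ℝ => K * δ ^ (θ - 1) * T) 0 := by
      refine ((Real.continuousAt_rpow_const 0 (θ - 1) (Or.inr (by linarith))).const_mul K).mul_const T
    have h := this.tendsto
    simp only [Real.zero_rpow (show θ - 1 ≠ 0 by linarith), mul_zero, zero_mul] at h
    exact h.mono_left nhdsWithin_le_nhds
  obtain ⟨δ, hδε, hδ⟩ := ((hcont.eventually (gt_mem_nhds hε)).and self_mem_nhdsWithin).exists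
  refine ⟨δ, hδ, fun n τ hτ h0 hn hmesh => ?_⟩
  have hpos : ∀ i, 0 ≤ τ i := fun i => h0 ▸ hτ (Nat.zero_le i)
  have hle : ∀ i ≤ n, τ i ≤ T := fun i hi => hn ▸ hτ hi
  have hsum : ∀ m ≤ n, I 0 (τ m) = ∑ i ∈ Finset.range m, I (τ i) (τ (i + 1)) := by
    intro m
    induction m with
    | zero =>
      intro _
      have := hadd 0 0 0 le_rfl le_rfl le_rfl hT
      rw [h0, Finset.sum_range_zero]
      simpa using this
    | succ m ih =>
      intro hm
      rw [Finset.sum_range_succ, ← ih (by omega)]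
      exact hadd 0 (τ m) (τ (m + 1)) le_rfl (hpos m) (hτ m.le_succ) (hle _ hm)
  rw [← hn, hsum n le_rfl, ← Finset.sum_sub_distrib]
  have hmin : ∀ k, min n (k + 1) ≤ min n k + 1 := fun k => by omega
  -- The partition is frozen after index `n`, since the mesh and term bounds are required at every
  -- index.
  have hb := norm_sum_le_of_norm_le_rpow (n := n) (h := δ) hθ hK
    (x := fun k => τ (min n k)) (fun a b hab => hτ (by omega))
    (v := fun k => if k < n then Ξ (τ k) (τ (k + 1)) - I (τ k) (τ (k + 1)) else 0) ?_ ?_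
  · simp only [min_self, h0, Nat.min_zero, hn] at hb
    rw [Finset.sum_congr rfl fun k hk => if_pos (Finset.mem_range.1 hk)] at hb
    refine hb.trans_lt ?_
    simpa using hδε
  · intro k
    rcases lt_or_ge k n with hk | hk
    · simp only [min_eq_right hk.le, min_eq_right (show k + 1 ≤ n from hk)]
      exact (hmesh k hk).le
    · simp only [min_eq_left hk, min_eq_left (show n ≤ k + 1 by omega), sub_self]
      exact le_of_lt hδ
  · intro k
    rcases lt_or_ge k n with hk | hk
    · simp only [min_eq_right hk.le, min_eq_right (show k + 1 ≤ n from hk), if_pos hk]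
      rw [norm_sub_rev]
      exact hI _ _ (hpos k) (hτ k.le_succ) (hle _ hk)
    · simp [not_lt.2 hk, min_eq_left hk, min_eq_left (show n ≤ k + 1 by omega),
        Real.zero_rpow (show θ ≠ 0 by linarith)]

end Sewing

/-! ### Concatenation product and `ℓ¹` norm of tensor series -/

namespace TSeries

open scoped ENNReal NNReal

variable {d : ℕ}

lemma tmul_nil (a b : TSeries d) : tmul a b [] = a [] * b [] := by simp [tmul]

lemma tmul_cons (a b : TSeries d) (x : Fin d) (I : List (Fin d)) :
    tmul a b (x :: I) = a [] * b (x :: I) + tmul (fun J => a (x :: J)) b I := by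
  rw [tmul, List.length_cons, Finset.sum_range_succ', add_comm]
  simp [tmul]

lemma tmul_add_left (a a' b : TSeries d) : tmul (a + a') b = tmul a b + tmul a' b := by
  funext I
  simp [tmul, add_mul, Finset.sum_add_distrib]

lemma tmul_smul_left (c : ℝ) (a b : TSeries d) : tmul (c • a) b = c • tmul a b := by
  funext I
  simp [tmul, Finset.mul_sum, mul_assoc]

lemma tmul_add_right (a b b' : TSeries d) : tmul a (b + b') = tmul a b + tmul a b' := by
  funext I
  simp [tmul, mul_add, Finset.sum_add_distrib]

lemma tmul_sub_right (a b b' : TSeries d) : tmul a (b - b') = tmul a b - tmul a b' := by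
  funext I
  simp [tmul, mul_sub, Finset.sum_sub_distrib]

lemma tmul_sub_left (a a' b : TSeries d) : tmul (a - a') b = tmul a b - tmul a' b := by
  funext I
  simp [tmul, sub_mul, Finset.sum_sub_distrib]

lemma tmul_smul_right (c : ℝ) (a b : TSeries d) : tmul a (c • b) = c • tmul a b := by
  funext I
  simp [tmul, Finset.mul_sum, mul_left_comm]

/-- Peeling off the first letter gives a recursion in which `a` is replaced by `J ↦ a (x :: J)`,
hence the induction over all `a`. -/
lemma tmul_assoc (a b c : TSeries d) : tmul (tmul a b) c = tmul a (tmul b c) := by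
  funext I
  induction I generalizing a with
  | nil => simp [tmul_nil, mul_assoc]
  | cons x I ih =>
    have h : (fun J => tmul a b (x :: J)) =
        a [] • (fun J => b (x :: J)) + tmul (fun J => a (x :: J)) b := by
      funext J
      rw [tmul_cons]
      rfl
    rw [tmul_cons, tmul_cons, h, tmul_add_left, tmul_smul_left, Pi.add_apply, Pi.smul_apply, ih,
      tmul_cons, tmul_nil, smul_eq_mul]
    ring

lemma tmul_word_nil (a : TSeries d) : tmul a (word []) = a := by
  funext I
  rw [tmul, Finset.sum_eq_single I.length]
  · simp [word]
  · intro i hi hne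
    have : I.drop i ≠ [] := by
      rw [Ne, List.drop_eq_nil_iff]
      have := Finset.mem_range.1 hi
      omega
    simp [word, this]
  · simp

/-- The terms of `tmul a b I` for which neither factor is the empty word. -/
def tmulMid (a b : TSeries d) (I : List (Fin d)) : ℝ :=
  ∑ i ∈ Finset.Ico 1 I.length, a (I.take i) * b (I.drop i)

/-- When both level-zero coefficients are `1`, this makes Chen's relation at `I` additivity up to
`tmulMid`, which sees only shorter nonempty words. The inductions on word length rest on it. -/
lemma tmul_eq_add_tmulMid (a b : TSeries d) {I : List (Fin d)} (hI : I ≠ []) :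
    tmul a b I = a [] * b I + a I * b [] + tmulMid a b I := by
  have hpos : 0 < I.length := List.length_pos_iff.2 hI
  rw [tmul, Finset.sum_range_succ, Finset.range_eq_Ico,
    Finset.sum_eq_sum_Ico_succ_bot hpos, tmulMid]
  simp
  ring

lemma tmul_congr {a a' b b' : TSeries d} {I : List (Fin d)}
    (ha : ∀ J : List (Fin d), J.length ≤ I.length → a J = a' J)
    (hb : ∀ J : List (Fin d), J.length ≤ I.length → b J = b' J) :
    tmul a b I = tmul a' b' I := by
  refine Finset.sum_congr rfl fun i _ => ?_
  rw [ha _ (by simp), hb _ (by simp)]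

lemma tmulMid_congr {a a' b b' : TSeries d} {I : List (Fin d)}
    (ha : ∀ J : List (Fin d), J.length < I.length → a J = a' J)
    (hb : ∀ J : List (Fin d), J.length < I.length → b J = b' J) :
    tmulMid a b I = tmulMid a' b' I := by
  refine Finset.sum_congr rfl fun i hi => ?_
  rw [Finset.mem_Ico] at hi
  rw [ha _ (by simp; omega), hb _ (by simp; omega)]

/-- The `ℓ¹` norm of a tensor series. -/
def l1 (a : TSeries d) : ℝ≥0∞ := ∑' I, ‖a I‖ₑ

lemma l1_mono {a b : TSeries d} (h : ∀ I, |a I| ≤ |b I|) : l1 a ≤ l1 b :=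
  ENNReal.tsum_le_tsum fun I => enorm_le_iff_norm_le.2 (h I)

/-- A word with a cut is determined by its two pieces, so the sum over cuts is part of the double
sum over pairs of words. -/
lemma l1_tmul_le (a b : TSeries d) : l1 (tmul a b) ≤ l1 a * l1 b := by
  let f : (Σ I : List (Fin d), Fin (I.length + 1)) → List (Fin d) × List (Fin d) :=
    fun p => (p.1.take p.2, p.1.drop p.2)
  have hf : Function.Injective f := by
    rintro ⟨I, i⟩ ⟨J, j⟩ h
    simp only [f, Prod.mk.injEq] at h
    have hIJ : I = J := by
      rw [← List.take_append_drop i I, ← List.take_append_drop j J, h.1, h.2]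
    subst hIJ
    have hlen := congrArg List.length h.1
    have hi := i.2
    have hj := j.2
    simp only [List.length_take] at hlen
    have : i = j := Fin.ext (by omega)
    rw [this]
  calc l1 (tmul a b)
      ≤ ∑' I : List (Fin d), ∑ i : Fin (I.length + 1), ‖a (I.take i)‖ₑ * ‖b (I.drop i)‖ₑ := by
        refine ENNReal.tsum_le_tsum fun I => ?_
        rw [tmul, Finset.sum_range]
        refine (enorm_sum_le _ _).trans (Finset.sum_le_sum fun i _ => ?_)
        rw [enorm_mul]
    _ = ∑' p : (Σ I : List (Fin d), Fin (I.length + 1)), ‖a (f p).1‖ₑ * ‖b (f p).2‖ₑ := by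
        rw [ENNReal.tsum_sigma']
        refine tsum_congr fun I => ?_
        rw [tsum_fintype]
    _ ≤ ∑' q : List (Fin d) × List (Fin d), ‖a q.1‖ₑ * ‖b q.2‖ₑ :=
        ENNReal.tsum_comp_le_tsum_of_injective hf fun q => ‖a q.1‖ₑ * ‖b q.2‖ₑ
    _ = l1 a * l1 b := by
        rw [ENNReal.tsum_prod', l1, l1]
        simp_rw [ENNReal.tsum_mul_left, ENNReal.tsum_mul_right]

lemma l1_word (I : List (Fin d)) : l1 (word I) = 1 := by
  rw [l1, tsum_eq_single I]
  · simp [word]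
  · intro J hJ
    simp [word, hJ]

lemma l1_eq_tsum_length (a : TSeries d) :
    l1 a = ∑' n : ℕ, ∑ v : Fin n → Fin d, ‖a (List.ofFn v)‖ₑ := by
  rw [l1, ← List.equivSigmaTuple.symm.tsum_eq, ENNReal.tsum_sigma']
  refine tsum_congr fun n => ?_
  rw [tsum_fintype]
  rfl

lemma l1_lt_top_of_length {a : TSeries d} {M : ℕ}
    (ha : ∀ I : List (Fin d), M < I.length → a I = 0) : l1 a < ∞ := by
  rw [l1_eq_tsum_length, tsum_eq_sum (s := Finset.range (M + 1))]
  · exact ENNReal.sum_lt_top.2 fun n _ => ENNReal.sum_lt_top.2 fun v _ => enorm_lt_top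
  · intro n hn
    refine Finset.sum_eq_zero fun v _ => ?_
    rw [ha _ (by simpa using hn), enorm_zero]

/-- The part of a tensor series at levels at least `m`. -/
def tail (m : ℕ) (a : TSeries d) : TSeries d := fun I => if m ≤ I.length then a I else 0

lemma tail_zero (a : TSeries d) : tail 0 a = a := by
  funext I
  simp [tail]

lemma l1_tail_le (m : ℕ) (a : TSeries d) : l1 (tail m a) ≤ l1 a := by
  refine l1_mono fun I => ?_
  rw [tail]
  split_ifs
  · rfl
  · simp

/-- There are `d ^ n` words of length `n`, so the levels are dominated by a geometric series of
ratio `d * q`; the factor `2` bounds `(1 - d * q)⁻¹`. -/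
lemma l1_tail_le_of_geometric {a : TSeries d} {q : ℝ} (hq : 0 ≤ q) (hq2 : d * q ≤ 1 / 2)
    (ha : ∀ I : List (Fin d), |a I| ≤ q ^ I.length) (m : ℕ) :
    l1 (tail m a) ≤ ENNReal.ofReal (2 * (d * q) ^ m) := by
  have hdq : 0 ≤ d * q := by positivity
  have hsum : HasSum (fun n : ℕ => (d * q) ^ (n + m)) ((1 - d * q)⁻¹ * (d * q) ^ m) := by
    simp_rw [pow_add]
    exact (hasSum_geometric_of_lt_one hdq (by linarith)).mul_right _
  calc l1 (tail m a)
      ≤ ∑' n : ℕ, ENNReal.ofReal (if m ≤ n then (d * q) ^ n else 0) := by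
        rw [l1_eq_tsum_length]
        refine ENNReal.tsum_le_tsum fun n => ?_
        by_cases hn : m ≤ n
        · rw [if_pos hn]
          refine (Finset.sum_le_card_nsmul _ _ (ENNReal.ofReal (q ^ n)) fun v _ => ?_).trans_eq ?_
          · rw [tail, List.length_ofFn, if_pos hn, Real.enorm_eq_ofReal_abs]
            exact ENNReal.ofReal_le_ofReal (by simpa using ha (List.ofFn v))
          · rw [Finset.card_univ, Fintype.card_fun, Fintype.card_fin, Fintype.card_fin,
              nsmul_eq_mul, mul_pow, ENNReal.ofReal_mul (by positivity)]
            congr 1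
            rw [← Nat.cast_pow, ENNReal.ofReal_natCast]
        · simp [tail, hn]
    _ = ∑' n : ℕ, ENNReal.ofReal ((d * q) ^ (n + m)) := by
        rw [← Summable.sum_add_tsum_nat_add' (k := m) ENNReal.summable, Finset.sum_eq_zero, zero_add]
        · simp
        · intro n hn
          have := Finset.mem_range.1 hn
          simp [not_le.2 this]
    _ = ENNReal.ofReal ((1 - d * q)⁻¹ * (d * q) ^ m) := by
        rw [← hsum.tsum_eq, ENNReal.ofReal_tsum_of_nonneg (fun n => by positivity) hsum.summable]
    _ ≤ _ := by
        refine ENNReal.ofReal_le_ofReal (mul_le_mul_of_nonneg_right ?_ (by positivity))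
        rw [inv_le_comm₀ (by linarith) (by norm_num)]
        linarith

/-- Extension of a truncated tensor by zero. -/
def ofTrunc {M : ℕ} : TruncT d M →ₗ[ℝ] TSeries d where
  toFun a := fun I => if h : I.length ≤ M then a ⟨I, h⟩ else 0
  map_add' a b := by funext I; by_cases h : I.length ≤ M <;> simp [h]
  map_smul' c a := by funext I; by_cases h : I.length ≤ M <;> simp [h]

lemma ofTrunc_trunc_apply (M : ℕ) (a : TSeries d) (I : List (Fin d)) :
    ofTrunc (trunc M a) I = if I.length ≤ M then a I else 0 := by
  by_cases h : I.length ≤ M <;> simp [ofTrunc, trunc, h]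

lemma ofTrunc_trunc_word {M : ℕ} {I : List (Fin d)} (hI : I.length ≤ M) :
    ofTrunc (trunc M (word I)) = word I := by
  funext J
  rw [ofTrunc_trunc_apply]
  split_ifs with h
  · rfl
  · have : J ≠ I := fun e => h (e ▸ hI)
    simp [word, this]

lemma l1_ofTrunc_lt_top {M : ℕ} (a : TruncT d M) : l1 (ofTrunc a) < ∞ :=
  l1_lt_top_of_length (M := M) fun I hI => by simp [ofTrunc, not_le.2 hI]

/-- Truncating `a ⊗ e_I` at level `M` removes the levels of `a` above `M - |I|`. -/
lemma tmul_word_sub_ofTrunc_trunc {M : ℕ} {a b : TSeries d} {I : List (Fin d)}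
    (hI : I.length ≤ M) (hab : ∀ J : List (Fin d), J.length ≤ M → a J = b J) :
    tmul a (word I) - ofTrunc (trunc M (tmul b (word I))) =
      tmul (tail (M + 1 - I.length) a) (word I) := by
  funext J
  rw [Pi.sub_apply, ofTrunc_trunc_apply]
  split_ifs with hJ
  · rw [tmul_congr (fun J' h => (hab J' (h.trans hJ)).symm) (fun _ _ => rfl), sub_self, tmul]
    refine (Finset.sum_eq_zero fun i hi => ?_).symm
    by_cases h : J.drop i = I
    · have hlen := congrArg List.length h
      have := Finset.mem_range.1 hi
      rw [List.length_drop] at hlen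
      rw [tail, if_neg, zero_mul]
      rw [List.length_take]
      omega
    · simp [word, h]
  · rw [sub_zero, tmul, tmul]
    refine Finset.sum_congr rfl fun i hi => ?_
    by_cases h : J.drop i = I
    · have hlen := congrArg List.length h
      have := Finset.mem_range.1 hi
      rw [List.length_drop] at hlen
      rw [tail, if_pos]
      rw [List.length_take]
      omega
    · simp [word, h]

lemma memℓp_two_of_l1 {a : TSeries d} (ha : l1 a < ∞) : Memℓp a 2 := by
  have h1 : Memℓp a 1 := by
    refine memℓp_gen ?_
    simp only [ENNReal.toReal_one, Real.rpow_one]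
    exact summable_norm_iff.2 (Summable.of_enorm ha.ne)
  exact h1.of_exponent_ge (by norm_num)

lemma norm_lp_two_le {f : lp (fun _ : List (Fin d) => ℝ) 2} {C : ℝ} (hC : 0 ≤ C)
    (hf : l1 (f : List (Fin d) → ℝ) ≤ ENNReal.ofReal C) : ‖f‖ ≤ C := by
  refine lp.norm_le_of_forall_sum_le (by norm_num) hC fun s => ?_
  have h1 : ∑ I ∈ s, ‖f I‖ ≤ C := by
    rw [← ENNReal.ofReal_le_ofReal_iff hC, ENNReal.ofReal_sum_of_nonneg fun _ _ => norm_nonneg _]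
    refine le_trans ?_ ((ENNReal.sum_le_tsum s).trans hf)
    exact Finset.sum_le_sum fun I _ => (ofReal_norm _).le
  simp only [ENNReal.toReal_ofNat, Real.rpow_ofNat]
  calc ∑ I ∈ s, ‖f I‖ ^ 2 ≤ (∑ I ∈ s, ‖f I‖) ^ 2 :=
        Finset.sum_sq_le_sq_sum_of_nonneg fun _ _ => norm_nonneg _
    _ ≤ C ^ 2 := by gcongr

end TSeries

/-! ### Existence and uniqueness of the signature -/

lemma one_lt_mul_of_roughLevel_lt {α : ℝ} (hα : 0 < α) {n : ℕ} (hn : roughLevel α < n) :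
    1 < (n : ℝ) * α := by
  have h1 : 1 / α < n := (Nat.lt_floor_add_one (1 / α)).trans_le (by exact_mod_cast hn)
  rwa [div_lt_iff₀ hα] at h1

lemma rpow_length_mul_le {α s u t : ℝ} (hα : 0 < α) (hsu : s ≤ u) (hut : u ≤ t)
    {i n : ℕ} (hi : i ≤ n) :
    (u - s) ^ ((i : ℝ) * α) * (t - u) ^ (((n - i : ℕ) : ℝ) * α) ≤ (t - s) ^ ((n : ℝ) * α) := by
  have h0 : 0 ≤ t - s := by linarith
  calc (u - s) ^ ((i : ℝ) * α) * (t - u) ^ (((n - i : ℕ) : ℝ) * α)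
      ≤ (t - s) ^ ((i : ℝ) * α) * (t - s) ^ (((n - i : ℕ) : ℝ) * α) := by
        refine mul_le_mul (Real.rpow_le_rpow (by linarith) (by linarith) (by positivity))
          (Real.rpow_le_rpow (by linarith) (by linarith) (by positivity))
          (Real.rpow_nonneg (by linarith) _) (Real.rpow_nonneg h0 _)
    _ = _ := by
        rw [← Real.rpow_add_of_nonneg h0 (by positivity) (by positivity), Nat.cast_sub hi]
        ring_nf

namespace TSeries

variable {d : ℕ}

lemma abs_tmulMid_le {a b : TSeries d} {I : List (Fin d)} {B : ℝ}
    (h : ∀ i, 0 < i → i < I.length → |a (I.take i)| * |b (I.drop i)| ≤ B) :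
    |tmulMid a b I| ≤ (I.length - 1 : ℕ) * B := by
  refine (Finset.abs_sum_le_sum_abs _ _).trans ((Finset.sum_le_card_nsmul _ _ B ?_).trans_eq ?_)
  · intro i hi
    rw [Finset.mem_Ico] at hi
    rw [abs_mul]
    exact h i (by omega) hi.2
  · rw [Nat.card_Ico, nsmul_eq_mul]

end TSeries

namespace RoughPath

open TSeries

variable {d : ℕ} {α T : ℝ}

/-- `S` is an extension of `X` to a rough path with levels up to `n`. -/
structure IsExtension (X : RoughPath d α T) (n : ℕ) (S : ℝ → ℝ → TSeries d) : Prop where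
  eq_zero : ∀ s t I, ¬ (0 ≤ s ∧ s ≤ t ∧ t ≤ T ∧ I.length ≤ n) → S s t I = 0
  extend : ∀ s t, 0 ≤ s → s ≤ t → t ≤ T →
    ∀ I : List (Fin d), I.length ≤ roughLevel α → S s t I = X.toFun s t I
  chen : ∀ s u t, 0 ≤ s → s ≤ u → u ≤ t → t ≤ T → ∀ I : List (Fin d), I.length ≤ n →
    S s t I = tmul (S s u) (S u t) I
  bound : ∃ C : ℝ, 0 ≤ C ∧ ∀ s t, 0 ≤ s → s ≤ t → t ≤ T → ∀ I : List (Fin d), I.length ≤ n →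
    |S s t I| ≤ C * (t - s) ^ ((I.length : ℝ) * α)

lemma IsExtension.nil {X : RoughPath d α T} {n : ℕ} {S : ℝ → ℝ → TSeries d}
    (hS : X.IsExtension n S) {s t : ℝ} (hs : 0 ≤ s) (hst : s ≤ t) (ht : t ≤ T) :
    S s t [] = 1 := by
  rw [hS.extend s t hs hst ht [] (Nat.zero_le _), X.level_zero s t hs hst ht]

lemma isExtension_self (X : RoughPath d α T) : X.IsExtension (roughLevel α) X.toFun where
  eq_zero := X.eq_zero
  extend _ _ _ _ _ _ _ := rfl
  chen := X.chen
  bound := by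
    obtain ⟨C, hC⟩ := X.holder
    refine ⟨max C 0, le_max_right _ _, fun s t hs hst ht I hI => (hC s t hs hst ht I hI).trans ?_⟩
    exact mul_le_mul_of_nonneg_right (le_max_left _ _) (Real.rpow_nonneg (by linarith) _)

/-- Once shorter words agree, the difference at `I` is additive at midpoints and of order `|I| α >
1`, hence zero. The heights `n` and `m` may differ so that successive extensions can be glued. -/
lemma IsExtension.unique (hα : 0 < α) {X : RoughPath d α T} {n m : ℕ}
    {S S' : ℝ → ℝ → TSeries d} (hS : X.IsExtension n S) (hS' : X.IsExtension m S')
    {s t : ℝ} (hs : 0 ≤ s) (hst : s ≤ t) (ht : t ≤ T) {I : List (Fin d)}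
    (hn : I.length ≤ n) (hm : I.length ≤ m) : S s t I = S' s t I := by
  induction hk : I.length using Nat.strong_induction_on generalizing I s t with
  | _ k ih =>
    subst hk
    rcases le_or_gt I.length (roughLevel α) with hI | hI
    · rw [hS.extend s t hs hst ht I hI, hS'.extend s t hs hst ht I hI]
    have hne : I ≠ [] := by
      rintro rfl
      simp at hI
    obtain ⟨C, hC0, hC⟩ := hS.bound
    obtain ⟨C', hC0', hC'⟩ := hS'.bound
    have hb := norm_le_of_midpoint (R := fun s t => S s t I - S' s t I) (T := T)
      (K := C + C') (c := 0) (one_lt_mul_of_roughLevel_lt hα hI) ?_ ?_ hs hst ht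
    · rw [zero_div, zero_mul] at hb
      exact sub_eq_zero.1 (norm_le_zero_iff.1 hb)
    · intro s t hs hst ht
      rw [add_mul]
      exact (norm_sub_le _ _).trans (add_le_add (hC s t hs hst ht I hn) (hC' s t hs hst ht I hm))
    · intro s t hs hst ht
      have h1 : s ≤ (s + t) / 2 := by linarith
      have h2 : (s + t) / 2 ≤ t := by linarith
      have h3 : (s + t) / 2 ≤ T := h2.trans ht
      have h4 : 0 ≤ (s + t) / 2 := by linarith
      rw [hS.chen s _ t hs h1 h2 ht I hn, hS'.chen s _ t hs h1 h2 ht I hm,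
        tmul_eq_add_tmulMid _ _ hne, tmul_eq_add_tmulMid _ _ hne, hS.nil hs h1 h3,
        hS.nil h4 h2 ht, hS'.nil hs h1 h3, hS'.nil h4 h2 ht,
        tmulMid_congr (fun J hJ => ih J.length hJ hs h1 h3 (by omega) (by omega) rfl)
          (fun J hJ => ih J.length hJ h4 h2 ht (by omega) (by omega) rfl),
        zero_mul, norm_le_zero_iff]
      ring

/-- Chen's relation prescribes the defect of each new coefficient. Associativity makes this defect a
cocycle and its order `(n + 1) α` exceeds `1`, so it can be sewn. -/
lemma IsExtension.exists_succ (hα : 0 < α) (hT : 0 ≤ T) {X : RoughPath d α T} {n : ℕ}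
    (hn : roughLevel α ≤ n) {S : ℝ → ℝ → TSeries d} (hS : X.IsExtension n S) :
    ∃ S', X.IsExtension (n + 1) S' := by
  obtain ⟨C, hC0, hC⟩ := hS.bound
  -- Because `S` is set to `0` above level `n`, the product at a new word consists of its interior
  -- terms alone and is exactly the required defect.
  have hzero : ∀ s t (I : List (Fin d)), I.length = n + 1 → S s t I = 0 := fun s t I hI =>
    hS.eq_zero s t I fun h => by omega
  have hmid : ∀ s u t, ∀ I : List (Fin d), I.length = n + 1 →
      tmul (S s u) (S u t) I = tmulMid (S s u) (S u t) I := by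
    intro s u t I hI
    rw [tmul_eq_add_tmulMid _ _ (List.ne_nil_of_length_eq_add_one hI), hzero _ _ _ hI,
      hzero _ _ _ hI, mul_zero, zero_mul, add_zero, zero_add]
  have hne : ∀ I : List (Fin d), I.length = n + 1 → I ≠ [] := fun I hI =>
    List.ne_nil_of_length_eq_add_one hI
  have hR : ∀ I : List (Fin d), ∃ R : ℝ → ℝ → ℝ, I.length = n + 1 →
      (∀ s u t, 0 ≤ s → s ≤ u → u ≤ t → t ≤ T →
        R s t = R s u + R u t + tmul (S s u) (S u t) I) ∧
      ∀ s t, 0 ≤ s → s ≤ t → t ≤ T →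
        |R s t| ≤ 2 * (n * (C * C)) / (1 - 2 ^ (1 - ((n + 1 : ℕ) : ℝ) * α)) *
          (t - s) ^ (((n + 1 : ℕ) : ℝ) * α) := by
    intro I
    by_cases hI : I.length = n + 1
    -- A word of length `n + 1` has `n` interior cuts, each contributing at most `C * C`.
    · have hbound : ∀ s u t, 0 ≤ s → s ≤ u → u ≤ t → t ≤ T → ‖tmul (S s u) (S u t) I‖ ≤
          n * (C * C) * (t - s) ^ (((n + 1 : ℕ) : ℝ) * α) := by
        intro s u t hs hsu hut ht
        rw [hmid s u t I hI, Real.norm_eq_abs, mul_assoc]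
        have := abs_tmulMid_le (a := S s u) (b := S u t) (I := I)
          (B := C * C * (t - s) ^ (((n + 1 : ℕ) : ℝ) * α)) ?_
        · rwa [hI, Nat.add_sub_cancel] at this
        · intro i hi0 hi
          have h1 := hC s u hs hsu (hut.trans ht) (I.take i) (by simp; omega)
          have h2 := hC u t (hs.trans hsu) hut ht (I.drop i) (by simp; omega)
          rw [List.length_take, min_eq_left hi.le] at h1
          rw [List.length_drop, hI] at h2
          calc |S s u (I.take i)| * |S u t (I.drop i)|
              ≤ (C * (u - s) ^ ((i : ℝ) * α)) * (C * (t - u) ^ (((n + 1 - i : ℕ) : ℝ) * α)) :=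
                mul_le_mul h1 h2 (abs_nonneg _)
                  (mul_nonneg hC0 (Real.rpow_nonneg (by linarith) _))
            _ = C * C * ((u - s) ^ ((i : ℝ) * α) * (t - u) ^ (((n + 1 - i : ℕ) : ℝ) * α)) := by
                ring
            _ ≤ _ := mul_le_mul_of_nonneg_left
                (rpow_length_mul_le hα hsu hut (by omega)) (by positivity)
      have hcoc : ∀ s u t, 0 ≤ s → s ≤ u → u ≤ t → t ≤ T →
          tmul (S 0 s) (S s t) I + tmul (S s u) (S u t) I =
            tmul (S 0 u) (S u t) I + tmul (S 0 s) (S s u) I := by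
        intro s u t hs hsu hut ht
        -- After Chen's relation is applied to the shorter words, associativity at `I` is the
        -- cocycle identity.
        have hassoc := congrFun (tmul_assoc (S 0 s) (S s u) (S u t)) I
        rw [tmul_eq_add_tmulMid (tmul (S 0 s) (S s u)) _ (hne I hI),
          tmul_eq_add_tmulMid (S 0 s) (tmul (S s u) (S u t)) (hne I hI), hzero u t I hI, hzero 0 s I hI, hS.nil (hs.trans hsu) hut ht,
          hS.nil le_rfl hs (hsu.trans (hut.trans ht)),
          tmulMid_congr (a' := S 0 u) (b' := S u t)
            (fun J hJ => (hS.chen 0 s u le_rfl hs hsu (hut.trans ht) J (by omega)).symm)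
            (fun _ _ => rfl),
          tmulMid_congr (b := tmul (S s u) (S u t)) (a' := S 0 s) (b' := S s t) (fun _ _ => rfl)
            (fun J hJ => (hS.chen s u t hs hsu hut ht J (by omega)).symm)] at hassoc
        simp only [hmid 0 s t I hI, hmid 0 u t I hI]
        linarith
      obtain ⟨R, hR1, hR2⟩ := exists_sewing_of_cocycle (g := fun s u t => tmul (S s u) (S u t) I)
        hT (one_lt_mul_of_roughLevel_lt (n := n + 1) hα (by omega)) (by positivity) hbound hcoc
      exact ⟨R, fun _ => ⟨hR1, hR2⟩⟩
    · exact ⟨0, fun h => absurd h hI⟩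
  choose R hR using hR
  let S' : ℝ → ℝ → TSeries d := fun s t I =>
    if I.length = n + 1 then (if 0 ≤ s ∧ s ≤ t ∧ t ≤ T then R I s t else 0) else S s t I
  have hold : ∀ s t (I : List (Fin d)), I.length ≠ n + 1 → S' s t I = S s t I :=
    fun s t I hI => if_neg hI
  have hnew : ∀ s t (I : List (Fin d)), I.length = n + 1 → 0 ≤ s → s ≤ t → t ≤ T →
      S' s t I = R I s t := fun s t I hI h1 h2 h3 => by
    simp only [S', if_pos hI]
    exact if_pos ⟨h1, h2, h3⟩
  refine ⟨S', fun s t I h => ?_, fun s t hs hst ht I hI => ?_,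
    fun s u t hs hsu hut ht I hI => ?_, ?_⟩
  · by_cases hI : I.length = n + 1
    · simp only [S', if_pos hI]
      exact if_neg fun h' => h ⟨h'.1, h'.2.1, h'.2.2, hI.le⟩
    · rw [hold s t I hI]
      exact hS.eq_zero s t I fun h' => h ⟨h'.1, h'.2.1, h'.2.2.1, by omega⟩
  · rw [hold s t I (by omega), hS.extend s t hs hst ht I hI]
  · by_cases hI' : I.length = n + 1
    · rw [hnew s t I hI' hs (hsu.trans hut) ht, tmul_eq_add_tmulMid _ _ (hne I hI'),
        hnew s u I hI' hs hsu (hut.trans ht), hnew u t I hI' (hs.trans hsu) hut ht,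
        hold s u [] (by simp), hold u t [] (by simp), hS.nil hs hsu (hut.trans ht),
        hS.nil (hs.trans hsu) hut ht, (hR I hI').1 s u t hs hsu hut ht, hmid s u t I hI',
        tmulMid_congr (fun J hJ => hold s u J (by omega)) (fun J hJ => hold u t J (by omega))]
      ring
    · rw [hold s t I hI', hS.chen s u t hs hsu hut ht I (by omega)]
      exact tmul_congr (fun J hJ => (hold s u J (by omega)).symm)
        (fun J hJ => (hold u t J (by omega)).symm)
  · refine ⟨max C (2 * (n * (C * C)) / (1 - 2 ^ (1 - ((n + 1 : ℕ) : ℝ) * α))),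
      hC0.trans (le_max_left _ _), fun s t hs hst ht I hI => ?_⟩
    by_cases hI' : I.length = n + 1
    · rw [hnew s t I hI' hs hst ht, hI']
      exact ((hR I hI').2 s t hs hst ht).trans (mul_le_mul_of_nonneg_right (le_max_right _ _)
        (Real.rpow_nonneg (by linarith) _))
    · rw [hold s t I hI']
      exact (hC s t hs hst ht I (by omega)).trans (mul_le_mul_of_nonneg_right (le_max_left _ _)
        (Real.rpow_nonneg (by linarith) _))

lemma exists_isExtension (hα : 0 < α) (hT : 0 ≤ T) (X : RoughPath d α T) (k : ℕ) :
    ∃ S, X.IsExtension (roughLevel α + k) S := by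
  induction k with
  | zero => exact ⟨_, X.isExtension_self⟩
  | succ k ih =>
    obtain ⟨S, hS⟩ := ih
    exact hS.exists_succ hα hT (Nat.le_add_right _ _)

lemma IsSignature.isExtension {X : RoughPath d α T} {S : ℝ → ℝ → TSeries d}
    (hS : X.IsSignature S) (k : ℕ) :
    X.IsExtension (roughLevel α + k)
      (fun s t I => if I.length ≤ roughLevel α + k then S s t I else 0) where
  eq_zero s t I h := by
    split_ifs with hI
    · exact hS.eq_zero s t I fun h' => h ⟨h'.1, h'.2.1, h'.2.2, hI⟩
    · rfl
  extend s t hs hst ht I hI := by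
    rw [if_pos (by omega), hS.extend s t hs hst ht I hI]
  chen s u t hs hsu hut ht I hI := by
    rw [if_pos hI, hS.chen s u t hs hsu hut ht]
    exact tmul_congr (fun J hJ => (if_pos (hJ.trans hI)).symm)
      (fun J hJ => (if_pos (hJ.trans hI)).symm)
  bound := by
    choose C hC using hS.bound
    have hnn : ∀ i, 0 ≤ max (C i) 0 := fun i => le_max_right _ _
    refine ⟨∑ i ∈ Finset.range (roughLevel α + k + 1), max (C i) 0,
      Finset.sum_nonneg fun i _ => hnn i, fun s t hs hst ht I hI => ?_⟩
    rw [if_pos hI]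
    refine (hC I.length s t hs hst ht I rfl).trans (mul_le_mul_of_nonneg_right
      ((le_max_left _ 0).trans ?_) (Real.rpow_nonneg (by linarith) _))
    exact Finset.single_le_sum (f := fun i => max (C i) 0) (fun i _ => hnn i)
      (Finset.mem_range.2 (by omega))

lemma IsSignature.unique (hα : 0 < α) {X : RoughPath d α T} {S S' : ℝ → ℝ → TSeries d}
    (hS : X.IsSignature S) (hS' : X.IsSignature S') : S = S' := by
  funext s t I
  by_cases h : 0 ≤ s ∧ s ≤ t ∧ t ≤ T
  · have hI : I.length ≤ roughLevel α + I.length := by omega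
    simpa [hI] using (hS.isExtension I.length).unique hα (hS'.isExtension I.length) h.1 h.2.1 h.2.2
      hI hI
  · rw [hS.eq_zero s t I h, hS'.eq_zero s t I h]

/-- Lyons' extension theorem. -/
theorem exists_isSignature (hα : 0 < α) (hT : 0 ≤ T) (X : RoughPath d α T) :
    ∃ S, X.IsSignature S := by
  choose S hS using X.exists_isExtension hα hT
  have huniq : ∀ k s t, 0 ≤ s → s ≤ t → t ≤ T → ∀ I : List (Fin d), I.length ≤ k →
      S I.length s t I = S k s t I := fun k s t hs hst ht I hI =>
    (hS I.length).unique hα (hS k) hs hst ht (by omega) (by omega)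
  -- Each coefficient is read from an extension tall enough for its word; `huniq` makes the choices
  -- compatible in Chen's relation.
  refine ⟨fun s t I => S I.length s t I, fun s t I h => ?_, fun s t hs hst ht I hI => ?_,
    fun s u t hs hsu hut ht => ?_, fun n => ?_⟩
  · exact (hS I.length).eq_zero s t I fun h' => h ⟨h'.1, h'.2.1, h'.2.2.1⟩
  · exact (hS I.length).extend s t hs hst ht I hI
  · funext I
    rw [(hS I.length).chen s u t hs hsu hut ht I (by omega)]
    exact tmul_congr (fun J hJ => (huniq _ s u hs hsu (hut.trans ht) J hJ).symm)
      (fun J hJ => (huniq _ u t (hs.trans hsu) hut ht J hJ).symm)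
  · obtain ⟨C, _, hC⟩ := (hS n).bound
    refine ⟨C, fun s t hs hst ht I hI => ?_⟩
    subst hI
    exact hC s t hs hst ht I (by omega)

lemma isSignature_sig (hα : 0 < α) (hT : 0 ≤ T) (X : RoughPath d α T) : X.IsSignature X.sig :=
  Classical.epsilon_spec (X.exists_isSignature hα hT)

/-- Since `sig` is merely chosen, compatibility comes from uniqueness: the signature of `X`, cut off
at `r`, is a signature of the restriction. -/
lemma sig_restrict (hα : 0 < α) (X : RoughPath d α T) {r : ℝ} (hr0 : 0 ≤ r) (hr : r ≤ T)
    {s t : ℝ} (ht : t ≤ r) : (X.restrict r hr).sig s t = X.sig s t := by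
  have hX := X.isSignature_sig hα (hr0.trans hr)
  have h : (X.restrict r hr).IsSignature fun s t I => if t ≤ r then X.sig s t I else 0 := by
    refine ⟨fun s t I h => ?_, fun s t hs hst ht I hI => ?_,
      fun s u t hs hsu hut ht => ?_, fun n => ?_⟩
    · split_ifs with htr
      · exact hX.eq_zero s t I fun h' => h ⟨h'.1, h'.2.1, htr⟩
      · rfl
    · simp only [restrict, if_pos ht, hX.extend s t hs hst (ht.trans hr) I hI]
    · simp only [if_pos ht, if_pos (hut.trans ht)]
      exact hX.chen s u t hs hsu hut (ht.trans hr)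
    · obtain ⟨C, hC⟩ := hX.bound n
      refine ⟨C, fun s t hs hst ht I hI => ?_⟩
      rw [if_pos ht]
      exact hC s t hs hst (ht.trans hr) I hI
  rw [((X.restrict r hr).isSignature_sig hα hr0).unique hα h]
  simp [ht]

end RoughPath

/-! ### Geometric growth and `ℓ¹` bounds for the signature -/

lemma exists_forall_add_one_le_two_rpow {α : ℝ} (hα : 0 < α) :
    ∃ n₀ : ℕ, ∀ n : ℕ, n₀ ≤ n → (n : ℝ) + 1 ≤ 2 ^ ((n : ℝ) * α) := by
  have hr : (1 : ℝ) < 2 ^ α := Real.one_lt_rpow (by norm_num) hα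
  have h := tendsto_pow_const_div_const_pow_of_one_lt 1 hr
  obtain ⟨n₀, hn₀⟩ := Filter.eventually_atTop.1 (h.eventually (gt_mem_nhds (show (0 : ℝ) < 1 / 2 by
    norm_num)))
  refine ⟨max n₀ 1, fun n hn => ?_⟩
  have h1 := hn₀ n ((le_max_left _ _).trans hn)
  have h2 : (1 : ℝ) ≤ n := by exact_mod_cast (le_max_right _ _).trans hn
  rw [div_lt_iff₀ (by positivity), pow_one] at h1
  rw [mul_comm, Real.rpow_mul_natCast (by norm_num)]
  linarith

namespace RoughPath

open TSeries
open scoped ENNReal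

variable {d : ℕ} {α T : ℝ}

lemma IsSignature.nil {X : RoughPath d α T} {S : ℝ → ℝ → TSeries d}
    (hS : X.IsSignature S) {s t : ℝ} (hs : 0 ≤ s) (hst : s ≤ t) (ht : t ≤ T) :
    S s t [] = 1 := by
  rw [hS.extend s t hs hst ht [] (Nat.zero_le _), X.level_zero s t hs hst ht]

/-- The coefficients of the signature grow at most geometrically in the length of the word. -/
lemma IsSignature.exists_geometric_bound (hα : 0 < α) {X : RoughPath d α T}
    {S : ℝ → ℝ → TSeries d} (hS : X.IsSignature S) :
    ∃ K : ℝ, 1 ≤ K ∧ ∀ s t, 0 ≤ s → s ≤ t → t ≤ T → ∀ I : List (Fin d),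
      |S s t I| ≤ K ^ I.length * (t - s) ^ ((I.length : ℝ) * α) := by
  choose C hC using hS.bound
  obtain ⟨n₀, hn₀⟩ := exists_forall_add_one_le_two_rpow hα
  -- Lengths below `n₁` are absorbed into `K`; from `n₁` on, `n α > 1` and `n + 1 ≤ 2 ^ (n α)` both
  -- hold.
  set n₁ := max n₀ (roughLevel α + 1) with hn₁
  have hsum0 : ∀ i ∈ Finset.range n₁, 0 ≤ |C i| := fun i _ => abs_nonneg _
  refine ⟨1 + ∑ i ∈ Finset.range n₁, |C i|, le_add_of_nonneg_right (Finset.sum_nonneg hsum0), ?_⟩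
  set K := 1 + ∑ i ∈ Finset.range n₁, |C i| with hKdef
  have hK1 : 1 ≤ K := le_add_of_nonneg_right (Finset.sum_nonneg hsum0)
  intro s t hs hst ht I
  induction hk : I.length using Nat.strong_induction_on generalizing I s t with
  | _ n ih =>
    have hts : 0 ≤ (t - s) ^ ((n : ℝ) * α) := Real.rpow_nonneg (by linarith) _
    rcases Nat.eq_zero_or_pos n with rfl | hn0
    · rw [List.length_eq_zero_iff.1 hk, hS.nil hs hst ht]
      simp
    rcases lt_or_ge n n₁ with hn | hn
    · refine (hC n s t hs hst ht I hk).trans (mul_le_mul_of_nonneg_right ?_ hts)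
      calc C n ≤ |C n| := le_abs_self _
        _ ≤ ∑ i ∈ Finset.range n₁, |C i| :=
          Finset.single_le_sum (f := fun i => |C i|) hsum0 (Finset.mem_range.2 hn)
        _ ≤ K := by rw [hKdef]; linarith
        _ ≤ K ^ n := le_self_pow₀ hK1 hn0.ne'
    have hne : I ≠ [] := by
      rintro rfl
      simp at hk
      omega
    have hθ : 1 < (n : ℝ) * α := one_lt_mul_of_roughLevel_lt hα (by omega)
    have hb := norm_le_of_midpoint (R := fun s t => S s t I) (T := T) (K := C n)
      (c := (n - 1 : ℕ) * (K ^ n * (1 / 2) ^ ((n : ℝ) * α))) hθ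
      (fun s t hs hst ht => hC n s t hs hst ht I hk) ?_ hs hst ht
    · refine hb.trans (mul_le_mul_of_nonneg_right ?_ hts)
      have hy := hn₀ n ((le_max_left _ _).trans hn)
      have hn1 : (1 : ℝ) ≤ n := by exact_mod_cast hn0
      have hy2 : (2 : ℝ) < 2 ^ ((n : ℝ) * α) := by
        simpa using Real.rpow_lt_rpow_of_exponent_lt (by norm_num : (1 : ℝ) < 2) hθ
      rw [Real.rpow_sub (by norm_num), Real.rpow_one, Real.div_rpow (by norm_num) (by norm_num),
        Real.one_rpow, Nat.cast_sub hn0, Nat.cast_one]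
      set y : ℝ := 2 ^ ((n : ℝ) * α)
      -- The `n - 1` interior cuts at the midpoint gain `1 / y` in size. The resulting factor is at
      -- most `1` because `y ≥ n + 1`, so the induction closes with the same `K`.
      have e : ((n : ℝ) - 1) * (K ^ n * (1 / y)) / (1 - 2 / y) = K ^ n * ((n - 1) / (y - 2)) := by
        have h1 : y ≠ 0 := by linarith
        have h2 : y - 2 ≠ 0 := by linarith
        have h3 : 1 - 2 / y ≠ 0 := by
          rw [one_sub_div h1]
          exact div_ne_zero h2 h1
        field_simp
      rw [e]
      refine mul_le_of_le_one_right (by positivity) ?_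
      rw [div_le_one (by linarith)]
      linarith
    · intro s t hs hst ht
      have h1 : s ≤ (s + t) / 2 := by linarith
      have h2 : (s + t) / 2 ≤ t := by linarith
      have h3 : (s + t) / 2 ≤ T := h2.trans ht
      have h4 : 0 ≤ (s + t) / 2 := by linarith
      have h5 : 0 ≤ (t - s) / 2 := by linarith
      have e : S s t I - S s ((s + t) / 2) I - S ((s + t) / 2) t I =
          tmulMid (S s ((s + t) / 2)) (S ((s + t) / 2) t) I := by
        rw [hS.chen s _ t hs h1 h2 ht, tmul_eq_add_tmulMid _ _ hne, hS.nil hs h1 h3,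
          hS.nil h4 h2 ht]
        ring
      simp only [e, Real.norm_eq_abs]
      rw [mul_assoc, ← hk]
      refine abs_tmulMid_le fun i hi0 hi => ?_
      have b1 := ih i (by omega) s ((s + t) / 2) hs h1 h3 (I.take i) (by simp; omega)
      have b2 := ih (n - i) (by omega) ((s + t) / 2) t h4 h2 ht (I.drop i) (by simp; omega)
      rw [show (s + t) / 2 - s = (t - s) / 2 by ring] at b1
      rw [show t - (s + t) / 2 = (t - s) / 2 by ring] at b2
      refine (mul_le_mul b1 b2 (abs_nonneg _) (by positivity)).trans_eq ?_
      have hin : i ≤ n := by omega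
      rw [hk, mul_mul_mul_comm, ← pow_add, Nat.add_sub_cancel' hin,
        ← Real.rpow_add_of_nonneg h5 (by positivity) (by positivity), ← add_mul, ← Nat.cast_add,
        Nat.add_sub_cancel' hin, div_eq_mul_one_div, Real.mul_rpow (by linarith) (by norm_num)]
      ring

/-- The signature is uniformly bounded in `ℓ¹`, and its part at levels at least `m` is of order
`(t - s)^{m α}`. -/
theorem IsSignature.exists_l1_tail_le (hα : 0 < α) {X : RoughPath d α T}
    {S : ℝ → ℝ → TSeries d} (hS : X.IsSignature S) (m : ℕ) :
    ∃ C : ℝ, 0 ≤ C ∧ ∀ s t, 0 ≤ s → s ≤ t → t ≤ T →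
      l1 (tail m (S s t)) ≤ ENNReal.ofReal (C * (t - s) ^ ((m : ℝ) * α)) := by
  obtain ⟨K, hK1, hK⟩ := hS.exists_geometric_bound hα
  obtain ⟨δ, hδ, hδK⟩ : ∃ δ : ℝ, 0 < δ ∧ d * (K * δ ^ α) ≤ 1 / 2 := by
    refine ⟨(1 / (2 * (d + 1) * K)) ^ (1 / α), by positivity, ?_⟩
    rw [← Real.rpow_mul (by positivity), one_div_mul_cancel hα.ne', Real.rpow_one]
    rw [show (d : ℝ) * (K * (1 / (2 * (d + 1) * K))) = d / (d + 1) * (1 / 2) by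
      have : K ≠ 0 := by linarith
      field_simp]
    refine mul_le_of_le_one_left (by norm_num) ?_
    rw [div_le_one (by positivity)]
    linarith
  have hpow : ∀ {x : ℝ}, 0 ≤ x → ∀ n : ℕ, x ^ ((n : ℝ) * α) = (x ^ α) ^ n := fun hx n => by
    rw [mul_comm, Real.rpow_mul_natCast hx]
  have hsmall : ∀ m s t, 0 ≤ s → s ≤ t → t ≤ T → t - s ≤ δ →
      l1 (tail m (S s t)) ≤ ENNReal.ofReal (2 * (d * (K * (t - s) ^ α)) ^ m) := by
    intro m s t hs hst ht hδts
    have hts : 0 ≤ t - s := by linarith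
    refine l1_tail_le_of_geometric (by positivity) (hδK.trans' ?_) (fun I => ?_) m
    · gcongr
    · rw [mul_pow, ← hpow hts]
      exact hK s t hs hst ht I
  -- Pieces of length at most `δ` are cut off at the right end, each costing a factor `2` by Chen
  -- and submultiplicativity.
  have hchain : ∀ k : ℕ, ∀ s t, 0 ≤ s → s ≤ t → t ≤ T → t - s ≤ (k + 1) * δ →
      l1 (S s t) ≤ 2 ^ (k + 1) := by
    have h2 : ∀ s t, 0 ≤ s → s ≤ t → t ≤ T → t - s ≤ δ → l1 (S s t) ≤ 2 := by
      intro s t hs hst ht h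
      have := hsmall 0 s t hs hst ht h
      simpa [tail_zero] using this
    intro k
    induction k with
    | zero => simpa using h2
    | succ k ih =>
      intro s t hs hst ht hk
      have hsu : s ≤ max s (t - δ) := le_max_left _ _
      have hut : max s (t - δ) ≤ t := max_le hst (by linarith)
      rw [hS.chen s (max s (t - δ)) t hs hsu hut ht, pow_succ]
      refine (l1_tmul_le _ _).trans (mul_le_mul' (ih _ _ hs hsu (hut.trans ht) ?_)
        (h2 _ _ (hs.trans hsu) hut ht ?_))
      · push_cast at hk
        have : 0 ≤ (k + 1) * δ := by positivity
        rw [sub_le_iff_le_add]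
        exact max_le (by linarith) (by linarith)
      · linarith [le_max_right s (t - δ)]
  obtain ⟨k, hk⟩ := exists_nat_ge (T / δ)
  rw [div_le_iff₀ hδ] at hk
  have hbig : ∀ s t, 0 ≤ s → s ≤ t → t ≤ T → l1 (S s t) ≤ ENNReal.ofReal (2 ^ (k + 1)) := by
    intro s t hs hst ht
    rw [ENNReal.ofReal_pow (by norm_num), ENNReal.ofReal_ofNat]
    exact hchain k s t hs hst ht (by linarith)
  -- The first summand serves `t - s ≤ δ`; for `t - s ≥ δ` the second absorbs the uniform bound, as
  -- `((t - s) / δ) ^ (m α) ≥ 1`.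
  refine ⟨2 * (d * K) ^ m + 2 ^ (k + 1) * (δ ^ ((m : ℝ) * α))⁻¹, by positivity,
    fun s t hs hst ht => ?_⟩
  have hts : 0 ≤ t - s := by linarith
  have hx : 0 ≤ (t - s) ^ ((m : ℝ) * α) := Real.rpow_nonneg hts _
  rcases le_total (t - s) δ with h | h
  · refine (hsmall m s t hs hst ht h).trans (ENNReal.ofReal_le_ofReal ?_)
    rw [← mul_assoc, mul_pow, ← hpow hts, ← mul_assoc]
    refine mul_le_mul_of_nonneg_right (le_add_of_nonneg_right (by positivity)) hx
  · refine (l1_tail_le _ _).trans ((hbig s t hs hst ht).trans (ENNReal.ofReal_le_ofReal ?_))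
    have h1 : 1 ≤ (δ ^ ((m : ℝ) * α))⁻¹ * (t - s) ^ ((m : ℝ) * α) := by
      rw [inv_mul_eq_div, one_le_div (by positivity)]
      exact Real.rpow_le_rpow hδ.le h (by positivity)
    rw [add_mul, mul_assoc (2 ^ (k + 1))]
    have h3 : 0 ≤ 2 * (d * K) ^ m * (t - s) ^ ((m : ℝ) * α) := by positivity
    have h4 : (2 : ℝ) ^ (k + 1) ≤
        2 ^ (k + 1) * ((δ ^ ((m : ℝ) * α))⁻¹ * (t - s) ^ ((m : ℝ) * α)) :=
      le_mul_of_one_le_right (by positivity) h1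
    linarith

lemma IsSignature.exists_l1_le (hα : 0 < α) {X : RoughPath d α T}
    {S : ℝ → ℝ → TSeries d} (hS : X.IsSignature S) :
    ∃ C : ℝ, 0 ≤ C ∧ ∀ s t, 0 ≤ s → s ≤ t → t ≤ T → l1 (S s t) ≤ ENNReal.ofReal C := by
  obtain ⟨C, hC0, hC⟩ := hS.exists_l1_tail_le hα 0
  refine ⟨C, hC0, fun s t hs hst ht => ?_⟩
  have := hC s t hs hst ht
  simpa [tail_zero] using this

lemma IsSignature.l1_lt_top (hα : 0 < α) {X : RoughPath d α T}
    {S : ℝ → ℝ → TSeries d} (hS : X.IsSignature S) (s t : ℝ) : l1 (S s t) < ∞ := by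
  obtain ⟨C, -, hC⟩ := hS.exists_l1_le hα
  by_cases h : 0 ≤ s ∧ s ≤ t ∧ t ≤ T
  · exact (hC s t h.1 h.2.1 h.2.2).trans_lt ENNReal.ofReal_lt_top
  · have : l1 (S s t) = 0 := by
      rw [l1, ENNReal.tsum_eq_zero]
      intro I
      rw [hS.eq_zero s t I h, enorm_zero]
    rw [this]
    exact ENNReal.zero_lt_top

end RoughPath

/-! ### The controlled lift of the signature path -/

lemma one_le_roughLevel {α : ℝ} (hα₀ : 0 < α) (hα₁ : α < 1) : 1 ≤ roughLevel α := by
  rw [roughLevel, Nat.one_le_floor_iff, one_le_div hα₀]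
  exact hα₁.le

namespace TSeries

open scoped ENNReal

variable {d : ℕ}

/-- Left multiplication by an `ℓ¹` tensor series, as a map from truncated tensors to `ℓ²`. -/
def tmulLp (a : TSeries d) (ha : l1 a < ∞) (M : ℕ) :
    TruncT d M →ₗ[ℝ] lp (fun _ : List (Fin d) => ℝ) 2 where
  toFun b := ⟨tmul a (ofTrunc b), memℓp_two_of_l1
    ((l1_tmul_le _ _).trans_lt (ENNReal.mul_lt_top ha (l1_ofTrunc_lt_top b)))⟩
  map_add' b c := lp.ext <|
    show tmul a (ofTrunc (b + c)) = tmul a (ofTrunc b) + tmul a (ofTrunc c) by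
      rw [map_add, tmul_add_right]
  map_smul' r b := lp.ext <|
    show tmul a (ofTrunc (r • b)) = r • tmul a (ofTrunc b) by
      rw [map_smul, tmul_smul_right]

lemma coe_tmulLp (a : TSeries d) (ha : l1 a < ∞) {M : ℕ} (b : TruncT d M) :
    (tmulLp a ha M b : List (Fin d) → ℝ) = tmul a (ofTrunc b) := rfl

end TSeries

namespace RoughPath

open TSeries

variable {d : ℕ} {α T : ℝ}

/-- The path `t ↦ Sig(X̃)_{0,t}` has a Hölder continuous lift to an `ℓ²`-valued path that is
controlled by any rough path agreeing with `X̃` below the top level. -/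
theorem exists_lift_sig (hα₀ : 0 < α) (hα₁ : α < 1) (hT : 0 ≤ T) (X Xt : RoughPath d α T)
    (hagree : ∀ s t, 0 ≤ s → s ≤ t → t ≤ T →
      ∀ I : List (Fin d), I.length ≤ roughLevel α - 1 → X.toFun s t I = Xt.toFun s t I) :
    ∃ Y : Set.Icc (0 : ℝ) T → TruncT d (roughLevel α - 1) →ₗ[ℝ]
        lp (fun _ : List (Fin d) => ℝ) 2,
      IsControlledBy X Y ∧ IsHolderLift α Y ∧
      ∀ t, (Y t (trunc _ (word [])) : List (Fin d) → ℝ) = Xt.sig 0 t := by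
  have hN := one_le_roughLevel hα₀ hα₁
  have hS := Xt.isSignature_sig hα₀ hT
  obtain ⟨B, hB0, hB⟩ := hS.exists_l1_le hα₀
  choose C hC0 hC using hS.exists_l1_tail_le hα₀
  have hprod : ∀ (s t : Set.Icc (0 : ℝ) T) (m : ℕ) (I : List (Fin d)), s ≤ t →
      l1 (tmul (Xt.sig 0 s) (tmul (tail m (Xt.sig s t)) (word I))) ≤
        ENNReal.ofReal (B * C m * ((t : ℝ) - s) ^ ((m : ℝ) * α)) := by
    intro s t m I hst
    rw [mul_assoc, ENNReal.ofReal_mul hB0]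
    refine (l1_tmul_le _ _).trans (mul_le_mul' (hB 0 s le_rfl s.2.1 s.2.2) ?_)
    refine (l1_tmul_le _ _).trans ?_
    rw [l1_word, mul_one]
    exact hC m s t s.2.1 hst t.2.2
  have hchen : ∀ (s t : Set.Icc (0 : ℝ) T), s ≤ t →
      Xt.sig 0 t = tmul (Xt.sig 0 s) (Xt.sig s t) := fun s t hst =>
    hS.chen 0 s t le_rfl s.2.1 hst t.2.2
  have hnn : ∀ (s t : Set.Icc (0 : ℝ) T) (m : ℕ), s ≤ t →
      0 ≤ B * C m * ((t : ℝ) - s) ^ ((m : ℝ) * α) := fun s t m hst =>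
    mul_nonneg (mul_nonneg hB0 (hC0 m)) (Real.rpow_nonneg (sub_nonneg.2 hst) _)
  refine ⟨fun t => tmulLp (Xt.sig 0 t) (hS.l1_lt_top hα₀ 0 t) _, ?_, ?_, fun t => ?_⟩
  -- The tail constant depends on `m = N - |I|`; summing gives one constant for all words.
  · refine ⟨∑ m ∈ Finset.range (roughLevel α + 1), B * C m, fun s t hst I hI => ?_⟩
    have hm : roughLevel α - 1 + 1 - I.length = roughLevel α - I.length := by omega
    have hcast : (roughLevel α : ℝ) - I.length = (roughLevel α - I.length : ℕ) := by
      rw [Nat.cast_sub (by omega)]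
    rw [hcast]
    refine (norm_lp_two_le (hnn s t (roughLevel α - I.length) hst) ?_).trans
      (mul_le_mul_of_nonneg_right ?_ (Real.rpow_nonneg (sub_nonneg.2 hst) _))
    · refine le_of_eq_of_le ?_ (hprod s t (roughLevel α - I.length) I hst)
      rw [lp.coeFn_sub, coe_tmulLp, coe_tmulLp, ofTrunc_trunc_word hI, hchen s t hst, tmul_assoc,
        ← tmul_sub_right, tmul_word_sub_ofTrunc_trunc hI, hm]
      intro J hJ
      rw [hagree s t s.2.1 hst t.2.2 J hJ, hS.extend s t s.2.1 hst t.2.2 J (by omega)]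
    · exact Finset.single_le_sum (f := fun m => B * C m)
        (fun m _ => mul_nonneg hB0 (hC0 m)) (Finset.mem_range.2 (by omega))
  · refine ⟨B * C 1, fun s t I hI => ?_⟩
    wlog hst : s ≤ t generalizing s t
    · rw [norm_sub_rev, abs_sub_comm]
      exact this t s (le_of_not_ge hst)
    have h1 := hnn s t 1 hst
    have h2 := hprod s t 1 I hst
    rw [Nat.cast_one, one_mul] at h1 h2
    rw [abs_of_nonneg (sub_nonneg.2 (show (s : ℝ) ≤ t from hst))]
    refine norm_lp_two_le h1 (le_of_eq_of_le ?_ h2)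
    -- The increment is `Sig_{0,s} ⊗ (Sig_{s,t} - 1) ⊗ e_I`, and removing `1` leaves the levels from
    -- one upwards, of order `α`.
    have htail : tail 1 (Xt.sig s t) = Xt.sig s t - word [] := by
      funext J
      rcases J with _ | ⟨x, J⟩
      · simp [tail, word, hS.nil s.2.1 hst t.2.2]
      · simp [tail, word]
    have hone : tmul (word []) (word I) = word I := by
      funext J
      cases J with
      | nil => simp [tmul_nil, word]
      | cons x J =>
        have : (fun K => word [] (x :: K)) = (0 : TSeries d) := by funext K; simp [word]
        rw [tmul_cons, this]
        simp [tmul, word]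
    rw [lp.coeFn_sub, coe_tmulLp, coe_tmulLp, ofTrunc_trunc_word hI, hchen s t hst, tmul_assoc,
      htail, tmul_sub_left, tmul_sub_right, hone]
  · rw [coe_tmulLp, ofTrunc_trunc_word (Nat.zero_le _), tmul_word_nil]

end RoughPath

section Comp

variable {d : ℕ} {α T : ℝ} {V W : Type*} [NormedAddCommGroup V] [NormedSpace ℝ V]
  [NormedAddCommGroup W] [NormedSpace ℝ W]

lemma IsControlledBy.comp {X : RoughPath d α T}
    {Y : Set.Icc (0 : ℝ) T → TruncT d (roughLevel α - 1) →ₗ[ℝ] V} (hY : IsControlledBy X Y)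
    (L : V →L[ℝ] W) : IsControlledBy X fun t => L.toLinearMap ∘ₗ Y t := by
  obtain ⟨C, hC⟩ := hY
  refine ⟨‖L‖ * C, fun s t hst I hI => ?_⟩
  rw [mul_assoc, LinearMap.comp_apply, LinearMap.comp_apply, ← map_sub]
  exact (L.le_opNorm _).trans (mul_le_mul_of_nonneg_left (hC s t hst I hI) (norm_nonneg _))

lemma IsHolderLift.comp {Y : Set.Icc (0 : ℝ) T → TruncT d (roughLevel α - 1) →ₗ[ℝ] V}
    (hY : IsHolderLift α Y) (L : V →L[ℝ] W) : IsHolderLift α fun t => L.toLinearMap ∘ₗ Y t := by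
  obtain ⟨C, hC⟩ := hY
  refine ⟨‖L‖ * C, fun s t I hI => ?_⟩
  rw [mul_assoc, LinearMap.comp_apply, LinearMap.comp_apply, ← map_sub]
  exact (L.le_opNorm _).trans (mul_le_mul_of_nonneg_left (hC s t I hI) (norm_nonneg _))

end Comp

/-! ### Sums over words and their cuts -/

section Words

variable {d : ℕ}

/-- The words of length less than `n`. -/
def wordsLT (d n : ℕ) : Finset (List (Fin d)) := (List.finite_length_lt (Fin d) n).toFinset

lemma mem_wordsLT {n : ℕ} {I : List (Fin d)} : I ∈ wordsLT d n ↔ I.length < n := by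
  simp [wordsLT]

variable {M : Type*} [AddCommMonoid M]

lemma sum_ofFn_eq_sum_wordsLT (n : ℕ) (f : List (Fin d) → M) :
    ∑ m ∈ Finset.range n, ∑ v : Fin m → Fin d, f (List.ofFn v) = ∑ I ∈ wordsLT d n, f I := by
  rw [Finset.sum_sigma']
  refine Finset.sum_bij' (fun p _ => List.ofFn p.2) (fun I _ => ⟨I.length, I.get⟩) ?_ ?_ ?_ ?_ ?_
  · rintro ⟨m, v⟩ h
    simpa [mem_wordsLT] using h
  · intro I hI
    simpa [mem_wordsLT] using hI
  · rintro ⟨m, v⟩ h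
    exact List.equivSigmaTuple.right_inv ⟨m, v⟩
  · intro I hI
    simp
  · rintro ⟨m, v⟩ h
    rfl

/-- A word with a cut is a prefix `J` and a suffix `L`. Grouping by `L` is what turns Chen's
expansion into the controlled defect. -/
lemma sum_wordsLT_take_drop (n : ℕ) (f : List (Fin d) → List (Fin d) → M) :
    ∑ I ∈ wordsLT d n, ∑ i ∈ Finset.range (I.length + 1), f (I.take i) (I.drop i) =
      ∑ L ∈ wordsLT d n, ∑ J ∈ wordsLT d (n - L.length), f J L := by
  rw [Finset.sum_sigma', Finset.sum_sigma']
  refine Finset.sum_bij' (fun p _ => ⟨p.1.drop p.2, p.1.take p.2⟩)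
    (fun q _ => ⟨q.2 ++ q.1, q.2.length⟩) ?_ ?_ ?_ ?_ ?_
  · rintro ⟨I, i⟩ h
    simp only [Finset.mem_sigma, mem_wordsLT, Finset.mem_range, List.length_drop,
      List.length_take] at h ⊢
    omega
  · rintro ⟨L, J⟩ h
    simp only [Finset.mem_sigma, mem_wordsLT, Finset.mem_range, List.length_append] at h ⊢
    omega
  · rintro ⟨I, i⟩ h
    simp only [Finset.mem_sigma, mem_wordsLT, Finset.mem_range] at h
    have : i ≤ I.length := by omega
    simp [this]
  · rintro ⟨L, J⟩ h
    simp
  · rintro ⟨I, i⟩ h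
    rfl

end Words

namespace TSeries

variable {d : ℕ}

lemma trunc_tmul_word (n : ℕ) (hn : 0 < n) (a : TSeries d) (L : List (Fin d)) :
    trunc (n - 1) (tmul a (word L)) =
      ∑ J ∈ wordsLT d (n - L.length), a J • trunc (n - 1) (word (J ++ L)) := by
  funext ⟨Q, hQ⟩
  rw [Finset.sum_apply]
  simp only [Pi.smul_apply, trunc, smul_eq_mul]
  by_cases h : ∃ J, J ++ L = Q
  · obtain ⟨J, rfl⟩ := h
    rw [List.length_append] at hQ
    rw [tmul, Finset.sum_eq_single J.length, Finset.sum_eq_single J]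
    · simp [word]
    · intro J' _ hJ'
      have : J ++ L ≠ J' ++ L := fun e => hJ' (List.append_cancel_right e).symm
      simp [word, this]
    · intro hJ
      exact absurd (mem_wordsLT.2 (by omega)) hJ
    · intro i hi hne
      have : (J ++ L).drop i ≠ L := by
        intro e
        have := congrArg List.length e
        have := Finset.mem_range.1 hi
        simp only [List.length_drop, List.length_append] at *
        omega
      simp only [word, Pi.single_apply, this, if_false, mul_zero]
    · simp
  · rw [tmul, Finset.sum_eq_zero, Finset.sum_eq_zero]
    · intro J _
      have : Q ≠ J ++ L := fun e => h ⟨J, e.symm⟩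
      simp only [word, Pi.single_apply, this, if_false, mul_zero]
    · intro i _
      have : Q.drop i ≠ L := fun e => h ⟨Q.take i, by rw [← e, List.take_append_drop]⟩
      simp only [word, Pi.single_apply, this, if_false, mul_zero]

lemma tmul_append_singleton (a b : TSeries d) (I : List (Fin d)) (k : Fin d) :
    tmul a b (I ++ [k]) = a (I ++ [k]) * b [] +
      ∑ i ∈ Finset.range (I.length + 1), a (I.take i) * b (I.drop i ++ [k]) := by
  rw [tmul, List.length_append, List.length_singleton, Finset.sum_range_succ, add_comm]
  congr 1
  · rw [List.take_of_length_le (by simp), List.drop_of_length_le (by simp)]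
  · refine Finset.sum_congr rfl fun i hi => ?_
    have : i ≤ I.length := by
      have := Finset.mem_range.1 hi
      omega
    rw [List.take_append_of_le_length this, List.drop_append_of_le_length this]

end TSeries

/-! ### Integration of controlled paths -/

section RoughIntegral

open TSeries

variable {d : ℕ} {α T : ℝ} {H : Type*} [NormedAddCommGroup H] [NormedSpace ℝ H]

lemma compensatedIncrement_eq (X : RoughPath d α T)
    (K : Set.Icc (0 : ℝ) T → TruncT d (roughLevel α - 1) →ₗ[ℝ] (EuclideanSpace ℝ (Fin d) →L[ℝ] H))
    (s t : Set.Icc (0 : ℝ) T) :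
    compensatedIncrement X K s t = ∑ k : Fin d, ∑ I ∈ wordsLT d (roughLevel α),
      X.toFun s t (I ++ [k]) • K s (trunc _ (word I)) (EuclideanSpace.single k 1) := by
  rw [compensatedIncrement, Finset.sum_comm, ← sum_ofFn_eq_sum_wordsLT (roughLevel α) (fun I =>
    ∑ k : Fin d, X.toFun s t (I ++ [k]) • K s (trunc _ (word I)) (EuclideanSpace.single k 1))]

/-- The compensated increments are additive up to the defect of `K` from being controlled. -/
lemma compensatedIncrement_sub (hα₀ : 0 < α) (hα₁ : α < 1) (X : RoughPath d α T)
    (K : Set.Icc (0 : ℝ) T → TruncT d (roughLevel α - 1) →ₗ[ℝ] (EuclideanSpace ℝ (Fin d) →L[ℝ] H))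
    {s u t : Set.Icc (0 : ℝ) T} (hsu : s ≤ u) (hut : u ≤ t) :
    compensatedIncrement X K s t - compensatedIncrement X K s u - compensatedIncrement X K u t =
      -∑ k : Fin d, ∑ L ∈ wordsLT d (roughLevel α), X.toFun u t (L ++ [k]) •
        (K u (trunc _ (word L)) - K s (trunc _ (tmul (X.toFun s u) (word L))))
          (EuclideanSpace.single k 1) := by
  have hN := one_le_roughLevel hα₀ hα₁
  rw [compensatedIncrement_eq, compensatedIncrement_eq, compensatedIncrement_eq,
    ← Finset.sum_sub_distrib, ← Finset.sum_sub_distrib, ← Finset.sum_neg_distrib]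
  refine Finset.sum_congr rfl fun k _ => ?_
  -- The term of Chen's relation with empty right factor cancels the increment over `[s, u]`; the
  -- remaining cuts fall before the letter `k`.
  have h1 : ∑ I ∈ wordsLT d (roughLevel α),
        X.toFun s t (I ++ [k]) • K s (trunc _ (word I)) (EuclideanSpace.single k 1) -
      ∑ I ∈ wordsLT d (roughLevel α),
        X.toFun s u (I ++ [k]) • K s (trunc _ (word I)) (EuclideanSpace.single k 1) =
      ∑ I ∈ wordsLT d (roughLevel α), ∑ i ∈ Finset.range (I.length + 1),
        (X.toFun s u (I.take i) * X.toFun u t (I.drop i ++ [k])) •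
          K s (trunc _ (word (I.take i ++ I.drop i))) (EuclideanSpace.single k 1) := by
    rw [← Finset.sum_sub_distrib]
    refine Finset.sum_congr rfl fun I hI => ?_
    have hI' := mem_wordsLT.1 hI
    simp only [List.take_append_drop]
    rw [← Finset.sum_smul, ← sub_smul]
    congr 1
    rw [X.chen s u t s.2.1 hsu hut t.2.2 _ (by simp; omega), tmul_append_singleton,
      X.level_zero u t u.2.1 hut t.2.2]
    ring
  -- For a fixed suffix `L`, the sum over `J` is `K_s` applied to the truncation of `X_{s,u} ⊗ e_L`.
  rw [h1, sum_wordsLT_take_drop (roughLevel α) (fun J L =>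
    (X.toFun s u J * X.toFun u t (L ++ [k])) •
          K s (trunc _ (word (J ++ L))) (EuclideanSpace.single k 1)), ← Finset.sum_sub_distrib,
    ← Finset.sum_neg_distrib]
  refine Finset.sum_congr rfl fun L _ => ?_
  rw [trunc_tmul_word (roughLevel α) hN, map_sum, sub_apply,
    sum_apply, smul_sub, Finset.smul_sum, neg_sub]
  congr 1
  refine Finset.sum_congr rfl fun J _ => ?_
  rw [map_smul, smul_apply, smul_smul, mul_comm]

/-- Controlled rough paths can be integrated. -/
theorem IsControlledBy.exists_isRoughIntegral [CompleteSpace H] (hα₀ : 0 < α) (hα₁ : α < 1)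
    (hT : 0 ≤ T) {X : RoughPath d α T}
    {K : Set.Icc (0 : ℝ) T → TruncT d (roughLevel α - 1) →ₗ[ℝ] (EuclideanSpace ℝ (Fin d) →L[ℝ] H)}
    (hK : IsControlledBy X K) : ∃ Φ, IsRoughIntegral X K Φ := by
  have hN := one_le_roughLevel hα₀ hα₁
  obtain ⟨C, hC⟩ := hK
  obtain ⟨C', hC'0, hC'⟩ := X.isExtension_self.bound
  set A : ℝ := ∑ _k : Fin d, ∑ _L ∈ wordsLT d (roughLevel α), C' * max C 0 with hA
  have hA0 : 0 ≤ A := Finset.sum_nonneg fun _ _ => Finset.sum_nonneg fun _ _ =>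
    mul_nonneg hC'0 (le_max_right _ _)
  let Ξ : ℝ → ℝ → H := fun s t =>
    compensatedIncrement X K (Set.projIcc 0 T hT s) (Set.projIcc 0 T hT t)
  have hΞ : ∀ s u t, 0 ≤ s → s ≤ u → u ≤ t → t ≤ T →
      ‖Ξ s t - Ξ s u - Ξ u t‖ ≤ A * (t - s) ^ (((roughLevel α + 1 : ℕ) : ℝ) * α) := by
    intro s u t hs hsu hut ht
    have es : ((Set.projIcc 0 T hT s : Set.Icc 0 T) : ℝ) = s := by
      rw [Set.projIcc_of_mem hT ⟨hs, hsu.trans (hut.trans ht)⟩]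
    have eu : ((Set.projIcc 0 T hT u : Set.Icc 0 T) : ℝ) = u := by
      rw [Set.projIcc_of_mem hT ⟨hs.trans hsu, hut.trans ht⟩]
    have et : ((Set.projIcc 0 T hT t : Set.Icc 0 T) : ℝ) = t := by
      rw [Set.projIcc_of_mem hT ⟨hs.trans (hsu.trans hut), ht⟩]
    simp only [Ξ]
    rw [compensatedIncrement_sub hα₀ hα₁ X K (Set.monotone_projIcc hT hsu)
      (Set.monotone_projIcc hT hut), norm_neg, hA, Finset.sum_mul]
    refine norm_sum_le_of_le _ fun k _ => ?_
    rw [Finset.sum_mul]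
    refine norm_sum_le_of_le _ fun L hL => ?_
    have hL' := mem_wordsLT.1 hL
    have h1 := hC' u t (hs.trans hsu) hut ht (L ++ [k]) (by simp; omega)
    have h2 := hC _ _ (Set.monotone_projIcc hT hsu) L (by omega)
    rw [es, eu] at h2
    rw [es, eu, et]
    rw [List.length_append, List.length_singleton] at h1
    have hcast : (roughLevel α : ℝ) - L.length = (roughLevel α - L.length : ℕ) := by
      rw [Nat.cast_sub hL'.le]
    rw [hcast] at h2
    -- The control exponent `(N - |L|) α` and the path exponent `(|L| + 1) α` add up to `(N + 1) α >
    -- 1` for every `L`.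
    have h3 := rpow_length_mul_le hα₀ hsu hut
      (show roughLevel α - L.length ≤ roughLevel α + 1 by omega)
    rw [show roughLevel α + 1 - (roughLevel α - L.length) = L.length + 1 by omega] at h3
    have hx : 0 ≤ (u - s) ^ (((roughLevel α - L.length : ℕ) : ℝ) * α) :=
      Real.rpow_nonneg (by linarith) _
    have hy : 0 ≤ (t - u) ^ (((L.length + 1 : ℕ) : ℝ) * α) := Real.rpow_nonneg (by linarith) _
    rw [norm_smul, Real.norm_eq_abs]
    calc _ ≤ (C' * (t - u) ^ (((L.length + 1 : ℕ) : ℝ) * α)) *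
          (max C 0 * (u - s) ^ (((roughLevel α - L.length : ℕ) : ℝ) * α)) := by
            refine mul_le_mul h1 ?_ (norm_nonneg _) (mul_nonneg hC'0 hy)
            refine (ContinuousLinearMap.le_opNorm _ _).trans ?_
            rw [PiLp.norm_single, norm_one, mul_one]
            exact h2.trans (mul_le_mul_of_nonneg_right (le_max_left _ _) hx)
      _ = C' * max C 0 * ((u - s) ^ (((roughLevel α - L.length : ℕ) : ℝ) * α) *
          (t - u) ^ (((L.length + 1 : ℕ) : ℝ) * α)) := by ring
      _ ≤ _ := mul_le_mul_of_nonneg_left h3 (mul_nonneg hC'0 (le_max_right _ _))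
  obtain ⟨Φ, hΦ⟩ := exists_limit_sum_of_sewing hT
    (one_lt_mul_of_roughLevel_lt hα₀ (Nat.lt_succ_self _)) hA0 hΞ
  refine ⟨Φ, fun ε hε => ?_⟩
  obtain ⟨δ, hδ, h⟩ := hΦ ε hε
  refine ⟨δ, hδ, fun n τ hτ h0 hn hmesh => ?_⟩
  let τ' : ℕ → Set.Icc (0 : ℝ) T := fun i => τ ⟨min i n, by omega⟩
  have hτ' : ∀ i : Fin n, τ' i = τ i.castSucc ∧ τ' (i + 1) = τ i.succ := by
    intro i
    have hi := i.2
    constructor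
    · refine congrArg τ (Fin.ext ?_)
      simp
    · refine congrArg τ (Fin.ext ?_)
      simp
  have key := h n (fun i => (τ' i : ℝ)) ?_ ?_ ?_ ?_
  · rw [Finset.sum_range] at key
    simpa only [Ξ, Set.projIcc_val, hτ'] using key
  · intro a b hab
    exact hτ (Fin.mk_le_mk.2 (by omega))
  · simpa [τ'] using h0
  · refine Eq.trans (congrArg (fun j => (τ j : ℝ)) (Fin.ext ?_)) hn
    simp
  · intro i hi
    have := hmesh ⟨i, hi⟩
    rw [← (hτ' ⟨i, hi⟩).1, ← (hτ' ⟨i, hi⟩).2] at this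
    exact this

end RoughIntegral

/-! ### Gram matrices -/

section Gram

/-- Two families of vectors with the same Gram matrix are related by a continuous linear map. -/
lemma exists_clm_of_inner_eq {ι V W : Type*} [NormedAddCommGroup V] [InnerProductSpace ℝ V]
    [CompleteSpace V] [NormedAddCommGroup W] [InnerProductSpace ℝ W] [CompleteSpace W]
    (f : ι → W) (g : ι → V) (h : ∀ i j, inner ℝ (f i) (f j) = inner ℝ (g i) (g j)) :
    ∃ Ψ : V →L[ℝ] W, ∀ i, Ψ (g i) = f i := by
  set F := Finsupp.linearCombination ℝ f
  set G := Finsupp.linearCombination ℝ g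
  have hnorm : ∀ c, ‖F c‖ = ‖G c‖ := by
    intro c
    rw [← sq_eq_sq₀ (norm_nonneg _) (norm_nonneg _), ← real_inner_self_eq_norm_sq,
      ← real_inner_self_eq_norm_sq]
    simp only [F, G, Finsupp.linearCombination_apply, Finsupp.sum, sum_inner, inner_sum,
      real_inner_smul_left, real_inner_smul_right, h]
  set U := (LinearMap.range G).topologicalClosure
  have hmem : ∀ c, G c ∈ U := fun c =>
    Submodule.le_topologicalClosure _ (LinearMap.mem_range_self G c)
  let G' : (ι →₀ ℝ) →ₗ[ℝ] U := G.codRestrict U hmem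
  have hdense : DenseRange G' := by
    rw [DenseRange, Subtype.dense_iff]
    intro x hx
    have himage : Subtype.val '' Set.range G' = (LinearMap.range G : Set V) := by
      rw [← Set.range_comp]
      rfl
    exact himage ▸ hx
  have : CompleteSpace U := (Submodule.isClosed_topologicalClosure _).completeSpace_coe
  have hbound : ∀ c, ‖F c‖ ≤ 1 * ‖G' c‖ := fun c => by
    rw [one_mul, hnorm]
    rfl
  -- Equal Gram matrices make `G c ↦ F c` isometric, so it extends to the closed span `U`; the
  -- orthogonal projection extends it by zero to `V`.
  refine ⟨F.extendOfNorm G' ∘L U.orthogonalProjectionOnto, fun i => ?_⟩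
  have hgi : G (Finsupp.single i 1) = g i := by simp [G]
  have hproj : U.orthogonalProjectionOnto (g i) = G' (Finsupp.single i 1) := by
    have hmem' := hmem (Finsupp.single i 1)
    rw [hgi] at hmem'
    rw [show g i = ((⟨g i, hmem'⟩ : U) : V) from rfl,
      Submodule.orthogonalProjectionOnto_mem_subspace_eq_self]
    exact Subtype.ext hgi.symm
  rw [ContinuousLinearMap.comp_apply, hproj, LinearMap.extendOfNorm_eq hdense ⟨1, hbound⟩]
  simp [F]

/-- A Gram matrix, times the identity, is positive semidefinite. -/
lemma posSemidef_inner_smul_id {ι V : Type*} [NormedAddCommGroup V] [InnerProductSpace ℝ V]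
    (d : ℕ) (g : ι → V) :
    (Matrix.of fun i j => inner ℝ (g i) (g j) •
      ContinuousLinearMap.id ℝ (EuclideanSpace ℝ (Fin d)) : Matrix ι ι _).PosSemidef := by
  have hiff := (RKHS.posSemidef_tfae (𝕜 := ℝ) (K := (Matrix.of fun i j => inner ℝ (g i) (g j) •
      ContinuousLinearMap.id ℝ (EuclideanSpace ℝ (Fin d)) : Matrix ι ι _))).out 0 2
  refine hiff.2 ⟨?_, fun v => ?_⟩
  · ext1 i j
    rw [Matrix.conjTranspose_apply, Matrix.of_apply, Matrix.of_apply, star_smul, real_inner_comm]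
    congr 1
    exact star_one (EuclideanSpace ℝ (Fin d) →L[ℝ] EuclideanSpace ℝ (Fin d))
  -- The identity factor splits the quadratic form into one squared norm per coordinate of `ℝ^d`.
  · have : (v.sum fun i w => v.sum fun j w' => inner ℝ ((Matrix.of fun i j =>
        inner ℝ (g i) (g j) • ContinuousLinearMap.id ℝ (EuclideanSpace ℝ (Fin d))) j i w) w') =
        ∑ k : Fin d, inner ℝ (∑ i ∈ v.support, v i k • g i) (∑ i ∈ v.support, v i k • g i) := by
      simp only [Finsupp.sum, sum_inner, inner_sum, real_inner_smul_left, real_inner_smul_right,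
        Matrix.of_apply, smul_apply, ContinuousLinearMap.id_apply, PiLp.inner_apply,
        RCLike.inner_apply, conj_trivial]
      rw [Finset.sum_comm (s := Finset.univ)]
      refine Finset.sum_congr rfl fun i _ => ?_
      rw [Finset.sum_comm (s := Finset.univ)]
      refine Finset.sum_congr rfl fun j _ => Finset.sum_congr rfl fun k _ => ?_
      rw [PiLp.smul_apply, smul_eq_mul]
      ring
    rw [this, RCLike.re_to_real]
    exact Finset.sum_nonneg fun k _ => real_inner_self_nonneg

end Gram

/-! ### From signatures to kernel functions, and the theorem -/

section SignatureKernel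

open TSeries

variable {d : ℕ} {α T : ℝ}

/-- The signature of a history over its whole interval, as an element of `ℓ²`. -/
def sigLp (hα : 0 < α) (Y : History d α T) : lp (fun _ : List (Fin d) => ℝ) 2 :=
  ⟨Y.2.sig 0 Y.1, memℓp_two_of_l1 ((Y.2.isSignature_sig hα Y.1.2.1).l1_lt_top hα _ _)⟩

lemma sigKernel_eq_inner (hα : 0 < α) (Y Z : History d α T) :
    sigKernel Y Z = inner ℝ (sigLp hα Y) (sigLp hα Z) := by
  rw [lp.inner_eq_tsum]
  refine tsum_congr fun I => ?_
  rw [RCLike.inner_apply, conj_trivial, mul_comm]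
  rfl

lemma tildeSigKernel_eq (hα : 0 < α) {D : Set (History d α T)} (tilde : D → History d α T) :
    tildeSigKernel tilde = .of fun Y Z => inner ℝ (sigLp hα (tilde Y)) (sigLp hα (tilde Z)) •
      ContinuousLinearMap.id ℝ (EuclideanSpace ℝ (Fin d)) := by
  ext1 Y Z
  simp only [tildeSigKernel, Matrix.of_apply, sigKernel_eq_inner hα]

/-- The map from `ℓ²` to the operators into the reproducing kernel Hilbert space that sends the
signature of `Ỹ` to the kernel function at `Y`. -/
lemma exists_clm_sigLp_eq_kerFun (hα : 0 < α) {D : Set (History d α T)}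
    (tilde : D → History d α T) (H : Type*) [NormedAddCommGroup H] [InnerProductSpace ℝ H]
    [CompleteSpace H] [RKHS ℝ H D (EuclideanSpace ℝ (Fin d))]
    (hH : RKHS.kernel H = tildeSigKernel tilde) :
    ∃ L : lp (fun _ : List (Fin d) => ℝ) 2 →L[ℝ] (EuclideanSpace ℝ (Fin d) →L[ℝ] H),
      ∀ Y, L (sigLp hα (tilde Y)) = RKHS.kerFun H Y := by
  -- For fixed `k`, the kernel functions in direction `e_k` have the same Gram matrix as the
  -- signatures, because `e_k` is a unit vector.
  have h : ∀ k : Fin d, ∃ Ψ : lp (fun _ : List (Fin d) => ℝ) 2 →L[ℝ] H,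
      ∀ Y, Ψ (sigLp hα (tilde Y)) = RKHS.kerFun H Y (EuclideanSpace.single k 1) := by
    intro k
    refine exists_clm_of_inner_eq _ _ fun Y Z => ?_
    rw [← RKHS.kernel_inner, hH, tildeSigKernel_eq hα, Matrix.of_apply, smul_apply,
      ContinuousLinearMap.id_apply, real_inner_smul_left, real_inner_self_eq_norm_sq,
      PiLp.norm_single, norm_one, one_pow, mul_one, real_inner_comm]
  choose Ψ hΨ using h
  refine ⟨∑ k, (ContinuousLinearMap.smulRightL ℝ (EuclideanSpace ℝ (Fin d)) H
    (EuclideanSpace.proj k)).comp (Ψ k), fun Y => ?_⟩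
  refine ContinuousLinearMap.ext fun v => ?_
  have hv : v = ∑ k, v k • EuclideanSpace.single k (1 : ℝ) := by
    ext j
    simp [Finset.sum_apply, Pi.single_apply]
  conv_rhs => rw [hv, map_sum]
  simp [sum_apply, hΨ]

end SignatureKernel

theorem mainTheorem8 (d : ℕ) (α T : ℝ) (hα₀ : 0 < α) (hα₁ : α < 1) (hT : 0 < T)
    (X Xt : RoughPath d α T)
    (hagree : ∀ s t, 0 ≤ s → s ≤ t → t ≤ T →
      ∀ I : List (Fin d), I.length ≤ roughLevel α - 1 → X.toFun s t I = Xt.toFun s t I)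
    (D : Set (History d α T)) (tilde : D → History d α T)
    (hD : ∀ s, X.history s ∈ D)
    (htilde : ∀ s, tilde ⟨X.history s, hD s⟩ = Xt.history s) :
    -- the signature is well defined and takes values in `ℓ²`
    (∃! S, Xt.IsSignature S) ∧
    (∀ s t, Memℓp (Xt.sig s t) 2) ∧
    -- as an `ℓ²`-valued path it is controlled by `X`
    (∃ Y : Set.Icc (0 : ℝ) T → TruncT d (roughLevel α - 1) →ₗ[ℝ]
        lp (fun _ : List (Fin d) => ℝ) 2,
      IsControlledBy X Y ∧
      ∀ t, (Y t (TSeries.trunc _ (TSeries.word [])) : List (Fin d) → ℝ) = Xt.sig 0 t) ∧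
    -- `K` is an operator-valued kernel
    (tildeSigKernel tilde).PosSemidef ∧
    -- in the RKHS of `K`, the path `s ↦ K(X|_[0,s], ·)` has a lift as required for rough
    -- integration against `X`, and the rough integral exists
    (∀ (H : Type*) [NormedAddCommGroup H] [InnerProductSpace ℝ H] [CompleteSpace H]
        [RKHS ℝ H D (EuclideanSpace ℝ (Fin d))],
      RKHS.kernel H = tildeSigKernel tilde →
      ∃ K : Set.Icc (0 : ℝ) T → TruncT d (roughLevel α - 1) →ₗ[ℝ]
          (EuclideanSpace ℝ (Fin d) →L[ℝ] H),
        Lifts K (fun s => RKHS.kerFun H (⟨X.history s, hD s⟩ : D)) ∧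
        IsControlledBy X K ∧
        IsHolderLift α K ∧
        ∃ Φ : H, IsRoughIntegral X K Φ) := by
  have hS := Xt.isSignature_sig hα₀ hT.le
  obtain ⟨Y, hY, hYα, hY0⟩ := RoughPath.exists_lift_sig hα₀ hα₁ hT.le X Xt hagree
  refine ⟨⟨Xt.sig, hS, fun S h => h.unique hα₀ hS⟩,
    fun s t => TSeries.memℓp_two_of_l1 (hS.l1_lt_top hα₀ s t), ⟨Y, hY, hY0⟩, ?_, ?_⟩
  · rw [tildeSigKernel_eq hα₀]
    exact posSemidef_inner_smul_id d _
  · intro H _ _ _ _ hH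
    obtain ⟨L, hL⟩ := exists_clm_sigLp_eq_kerFun hα₀ tilde H hH
    refine ⟨fun t => L.toLinearMap ∘ₗ Y t, fun t => ?_, hY.comp L, hYα.comp L,
      (hY.comp L).exists_isRoughIntegral hα₀ hα₁ hT.le⟩
    -- The lift property needs the signature of the history `X̃|_[0,t]` over its whole interval to
    -- be `Sig(X̃)_{0,t}`, which is `sig_restrict`.
    refine Eq.trans ?_ (hL _)
    rw [htilde]
    refine congrArg L (lp.ext ?_)
    rw [hY0]
    exact (Xt.sig_restrict hα₀ t.2.1 t.2.2 le_rfl).symm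

end
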